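/- Let $f\colon(0,\infty)\to\mathbb{R}$ be completely monotonic, i.e. $f$ is $C^\infty$ and $(-1)^kf^{(k)}(x)\ge 0$ for all $x>0$ and all integers $k\ge 0$, and suppose that $f(x)=O(x^{-1/2-\varepsilon})$ as $x\to\infty$ for some $\varepsilon>0$. Write $\widetilde f(x)=f(x^2)$ and $\widetilde f'(x)=2xf'(x^2)$ for $x\neq 0$, and define $h\colon\mathbb{R}\to\mathbb{R}$ by $$ h(x)=\sum_{k\in\mathbb{Z}\setminus\{0\}}\widetilde f(k)\left(\frac{\sin\pi(x-k)}{\pi(x-k)}\right)^2+\sum_{k\in\mathbb{Z}\setminus\{0\}}\widetilde f'(k)\,\frac{(\sin\pi(x-k))^2}{\pi^2(x-k)}-2\left(\frac{\sin\pi x}{\pi x}\right)^2\sum_{k=1}^{\infty}\bigl(\widetilde f(k)+k\widetilde f'(k)\bigr), $$ where at integers $x$ the fractions are replaced by their limits. All three series converge absolutely (the first two for every $x$). Moreover $h(x)\le f(x^2)$ for all $x\ne 0$, and there is a continuous function $\widehat h\colon\mathbb{R}\to\mathbb{R}$ with support in $[-1,1]$ and $\widehat h(t)\ge 0$ for all $t\in\mathbb{R}$,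 such that $h$ is the Fourier transform of $\widehat h$, that is, $h(x)=\int_{\mathbb{R}}\widehat h(t)e^{2\pi i xt}\,dt$ for all $x\in\mathbb{R}$, and such that $$ \widehat h(0)-h(0)=\sum_{k\in\mathbb{Z}\setminus\{0\}}f(k^2), $$ where the series converges. Thus the linear programming bound given by $h$ is sharp for $\mathbb{Z}$ in the following sense. For $L>0$, $N\ge 1$ and $v_1,\dots,v_N\in\mathbb{R}$ with $v_j-v_k\notin L\mathbb{Z}$ for $j\ne k$, the periodic configuration $\mathcal{C}=\bigcup_{j}(L\mathbb{Z}+v_j)$ has density $\delta=N/L$ and $f$-potential energy $$ E_f(\mathcal{C})=\frac1N\sum_{1\le j,k\le N}\ \sum_{x\in L\mathbb{Z},\ x+v_j-v_k\neq 0} f\bigl(|x+v_j-v_k|^2\bigr)\in[0,\infty]. $$ Every such $\mathcal{C}$ satisfies $E_f(\mathcal{C})\ge\delta\,\widehat h(0)-h(0)$, and equality holds for $\mathcal{C}=\mathbb{Z}$ (with $L=N=1$, $v_1=0$, $\delta=1$): $E_f(\mathbb{Z})=\widehat h(0)-h(0)$. -/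

import Mathlib

open Set Filter MeasureTheory
open scoped ContDiff ENNReal

noncomputable section

/-- A function `f` is completely monotonic on the set `s` if it is smooth on `s` and
`(-1)^k f^{(k)} ≥ 0` on `s` for all `k ≥ 0`. -/
def CompletelyMonotonicOn (f : ℝ → ℝ) (s : Set ℝ) : Prop :=
  ContDiffOn ℝ ∞ f s ∧ ∀ k : ℕ, ∀ x ∈ s, 0 ≤ (-1 : ℝ) ^ k * iteratedDerivWithin k f s x

/-- `radial f x = f (x ^ 2)`: the potential as a function of the signed distance. -/
def radial (f : ℝ → ℝ) (x : ℝ) : ℝ := f (x ^ 2)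

/-- `2 x f'(x ^ 2)`: the derivative of `radial f` at `x ≠ 0`. -/
def radialDeriv (f : ℝ → ℝ) (x : ℝ) : ℝ := 2 * x * deriv f (x ^ 2)

/-- The Fejér kernel `(sin (π x) / (π x)) ^ 2`, with the value `1` at `x = 0`. -/
def fejer (x : ℝ) : ℝ := Real.sinc (Real.pi * x) ^ 2

/-- The `k`-th value term, `f(k²) (sin π(x-k) / π(x-k))²`. -/
def valueTerm (f : ℝ → ℝ) (x : ℝ) (k : ℤ) : ℝ := radial f k * fejer (x - k)

/-- The `k`-th derivative term, `2 k f'(k²) (sin π(x-k))² / (π² (x-k))`, which is read as `0` (its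
limit) at `x = k`. -/
def derivTerm (f : ℝ → ℝ) (x : ℝ) (k : ℤ) : ℝ := radialDeriv f k * ((x - k) * fejer (x - k))

/-- The terms `f(k²) + k · 2 k f'(k²)` of the series that gives the value at `0`. -/
def originTerm (f : ℝ → ℝ) (k : ℕ) : ℝ := radial f k + k * radialDeriv f k

/-- The explicit band-limited function
`h(x) = ∑_{k ≠ 0} f(k²) (sin π(x-k) / π(x-k))² + ∑_{k ≠ 0} 2k f'(k²) (sin π(x-k))² / (π²(x-k))`
`- 2 (sin πx / πx)² ∑_{k ≥ 1} (f(k²) + 2k² f'(k²))`. -/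
def interpolant (f : ℝ → ℝ) (x : ℝ) : ℝ :=
  (∑' k : {k : ℤ // k ≠ 0}, valueTerm f x k) + (∑' k : {k : ℤ // k ≠ 0}, derivTerm f x k)
    - 2 * fejer x * ∑' k : ℕ, originTerm f (k + 1)

/-- A periodic point configuration on the line: the disjoint union of the `N ≥ 1` translates
`Lℤ + v j` of the lattice `Lℤ`, where `L > 0`. -/
structure PeriodicConfig where
  /-- the length of a period -/
  L : ℝ
  L_pos : 0 < L
  /-- the number of points in a period -/
  N : ℕ
  N_pos : 0 < N
  /-- representatives of the points modulo the lattice -/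
  v : Fin N → ℝ
  disjoint : ∀ j k : Fin N, j ≠ k → ∀ m : ℤ, v j - v k ≠ m * L

namespace PeriodicConfig

/-- The number of points per unit length. -/
def density (C : PeriodicConfig) : ℝ := C.N / C.L

/-- The `f`-potential energy
`(1/N) ∑_{j,k} ∑_{x ∈ Lℤ, x + v_j - v_k ≠ 0} f(|x + v_j - v_k|²)` for nonnegative `f`; it is `∞`
if the series diverges. -/
def energy (f : ℝ → ℝ) (C : PeriodicConfig) : ℝ≥0∞ :=
  (C.N : ℝ≥0∞)⁻¹ * ∑ j : Fin C.N, ∑ k : Fin C.N,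
    ∑' m : {m : ℤ // m * C.L + C.v j - C.v k ≠ 0},
      ENNReal.ofReal (f (|(m : ℤ) * C.L + C.v j - C.v k| ^ 2))

/-- The configuration `ℤ`: one translate of the lattice `ℤ`. -/
def integers : PeriodicConfig where
  L := 1
  L_pos := one_pos
  N := 1
  N_pos := one_pos
  v := fun _ => 0
  disjoint := fun j k hjk => absurd (Subsingleton.elim j k) hjk

end PeriodicConfig

end

/-!
The line is approximated by circles. Put the integers modulo `M = 2 N + 1` on a circle of
circumference `M`, where the squared chord length `chordSq N x` replaces `x ^ 2`. Interpolate
`f ∘ chordSq N` to second order at the nonzero integers modulo `M`. Newton's formula, with the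
nodes taken in pairs starting from the points farthest from the origin, writes the interpolant as a
combination of products of factors `chordSq N k - chordSq N x`, and complete monotonicity makes the
coefficients and the remainder nonnegative (`IsCMTower.exists_newton`: the negated divided
difference of a completely monotonic function is completely monotonic). The remainder contains each
factor twice, so the interpolant is at most `f ∘ chordSq N`. Each product is a cosine polynomial
with nonnegative coefficients (`isCosSum_partialProd`), because by the `q`-binomial theorem the
polynomial with zeros at consecutive `M`-th roots of unity placed symmetrically about `-1` has
nonnegative coefficients. Hence the interpolant on the circle has nonnegative coefficients.

These coefficients are determined by the values and derivatives at the nodes, together with the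
vanishing of the coefficient of the top degree `2 N` (`circleCoeff_sum`). As `N → ∞` they converge
to an explicit function `lineDual` on `[0, 1]`; all series involved are dominated by
`IsCMTower.majorant`, because `-f' x * (x / 2) ≤ f (x / 2)`. So `lineDual` is nonnegative, and the
interpolants on the circle, being Riemann sums, converge to twice the cosine transform of
`lineDual`, which is the interpolant on the line (`interpolant_eq_integral`). Both inequalities
survive in the limit.

For the linear programming bound, the sum of `h` over the differences of a configuration is
weighted by a wide Gaussian. Poisson summation for Gaussians turns it into the integral of
`hhat` against a sum of Gaussian bumps with nonnegative weights, of which only the bump at the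
origin is kept; it tends to a point mass as the Gaussian widens
(`PeriodicConfig.linear_programming_bound`).
-/

noncomputable section

/-! ### Completely monotonic functions and Newton interpolation -/

/-- The successive derivatives `F 0, F 1, …` of a completely monotonic function `F 0` on
`(0, ∞)`, kept as one sequence. -/
structure IsCMTower (F : ℕ → ℝ → ℝ) : Prop where
  hasDerivAt : ∀ k x, 0 < x → HasDerivAt (F k) (F (k + 1) x) x
  sign : ∀ k x, 0 < x → 0 ≤ (-1 : ℝ) ^ k * F k x

namespace CompletelyMonotonicOn

theorem isCMTower {f : ℝ → ℝ} (hf : CompletelyMonotonicOn f (Ioi 0)) :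
    IsCMTower fun k => iteratedDerivWithin k f (Ioi 0) := by
  refine ⟨fun k x hx => ?_, fun k x hx => hf.2 k x hx⟩
  have h1 : DifferentiableOn ℝ (iteratedDerivWithin k f (Ioi 0)) (Ioi 0) :=
    hf.1.differentiableOn_iteratedDerivWithin (by exact_mod_cast WithTop.coe_lt_top _)
      (uniqueDiffOn_Ioi 0)
  have h2 := (h1 x hx).hasDerivWithinAt.hasDerivAt (Ioi_mem_nhds hx)
  rw [iteratedDerivWithin_succ]
  exact h2

end CompletelyMonotonicOn

namespace IsCMTower

variable {F : ℕ → ℝ → ℝ}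

theorem continuousOn (hF : IsCMTower F) (k : ℕ) : ContinuousOn (F k) (Ioi 0) :=
  fun x hx => (hF.hasDerivAt k x hx).continuousAt.continuousWithinAt

theorem nonneg (hF : IsCMTower F) {x : ℝ} (hx : 0 < x) : 0 ≤ F 0 x := by
  simpa using hF.sign 0 x hx

theorem deriv_nonpos (hF : IsCMTower F) {x : ℝ} (hx : 0 < x) : F 1 x ≤ 0 := by
  have := hF.sign 1 x hx
  linarith

theorem antitoneOn (hF : IsCMTower F) : AntitoneOn (F 0) (Ioi 0) := by
  refine antitoneOn_of_deriv_nonpos (convex_Ioi 0) (hF.continuousOn 0) ?_ ?_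
  · rw [interior_Ioi]
    exact fun x hx => (hF.hasDerivAt 0 x hx).differentiableAt.differentiableWithinAt
  · rw [interior_Ioi]
    intro x hx
    rw [(hF.hasDerivAt 0 x hx).deriv]
    exact hF.deriv_nonpos hx

theorem monotoneOn_one (hF : IsCMTower F) : MonotoneOn (F 1) (Ioi 0) := by
  refine monotoneOn_of_deriv_nonneg (convex_Ioi 0) (hF.continuousOn 1) ?_ ?_
  · rw [interior_Ioi]
    exact fun x hx => (hF.hasDerivAt 1 x hx).differentiableAt.differentiableWithinAt
  · rw [interior_Ioi]
    intro x hx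
    rw [(hF.hasDerivAt 1 x hx).deriv]
    simpa using hF.sign 2 x hx

/-- By the mean value theorem on `[x / 2, x]`, where `F 1` is monotone. -/
theorem neg_deriv_mul_le (hF : IsCMTower F) {x : ℝ} (hx : 0 < x) :
    -F 1 x * (x / 2) ≤ F 0 (x / 2) := by
  have hlt : x / 2 < x := by linarith
  obtain ⟨c, hc, hc'⟩ := exists_hasDerivAt_eq_slope (F 0) (F 1) hlt
    ((hF.continuousOn 0).mono fun y hy => lt_of_lt_of_le (by positivity) hy.1)
    fun y hy => hF.hasDerivAt 0 y (lt_trans (by positivity) hy.1)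
  have hc0 : 0 < c := lt_trans (by positivity) hc.1
  have h1 : F 1 c ≤ F 1 x := hF.monotoneOn_one hc0 hx hc.2.le
  have h2 := hF.nonneg hx
  have h3 : F 0 x - F 0 (x / 2) = F 1 c * (x / 2) := by
    rw [hc']; field_simp; ring
  nlinarith

/-- The tower of the negated divided difference `y ↦ -(F 0 y - F 0 a) / (y - a)`, written as an
average of `-F 1` over the segment from `a` to `y`, which also covers `y = a`. -/
def slope (F : ℕ → ℝ → ℝ) (a : ℝ) (k : ℕ) (y : ℝ) : ℝ :=
  -∫ s in (0 : ℝ)..1, s ^ k * F (k + 1) (a + s * (y - a))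

theorem segment_pos {a y s : ℝ} (ha : 0 < a) (hy : 0 < y) (hs : s ∈ Icc (0 : ℝ) 1) :
    0 < a + s * (y - a) := by
  obtain ⟨h0, h1⟩ := hs
  rcases h1.lt_or_eq with h1 | rfl
  · nlinarith [mul_nonneg h0 hy.le, mul_pos (sub_pos.2 h1) ha]
  · linarith

theorem continuousOn_segment (hF : IsCMTower F) {a y : ℝ} (ha : 0 < a) (hy : 0 < y) (k l : ℕ) :
    ContinuousOn (fun s : ℝ => s ^ l * F k (a + s * (y - a))) (Icc 0 1) := by
  refine ContinuousOn.mul (by fun_prop) ?_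
  exact (hF.continuousOn k).comp (by fun_prop) fun s hs => segment_pos ha hy hs

theorem slope_zero_mul (hF : IsCMTower F) {a y : ℝ} (ha : 0 < a) (hy : 0 < y) :
    F 0 y = F 0 a + (a - y) * slope F a 0 y := by
  have h : ∫ s in (0 : ℝ)..1, F 1 (a + s * (y - a)) * (y - a) = F 0 y - F 0 a := by
    have := intervalIntegral.integral_eq_sub_of_hasDerivAt (a := 0) (b := 1)
      (f := fun s => F 0 (a + s * (y - a))) (f' := fun s => F 1 (a + s * (y - a)) * (y - a)) ?_ ?_
    · rw [this]; simp
    · intro s hs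
      rw [uIcc_of_le zero_le_one] at hs
      have h1 := hF.hasDerivAt 0 _ (segment_pos ha hy hs)
      have h2 : HasDerivAt (fun s : ℝ => a + s * (y - a)) (y - a) s := by
        simpa using ((hasDerivAt_id s).mul_const (y - a)).const_add a
      exact h1.comp s h2
    · refine ContinuousOn.intervalIntegrable ?_
      rw [uIcc_of_le zero_le_one]
      simpa using (hF.continuousOn_segment ha hy 1 0).mul_const (y - a)
  rw [intervalIntegral.integral_mul_const] at h
  simp only [slope, pow_zero, one_mul, zero_add]
  linarith

theorem hasDerivAt_slope (hF : IsCMTower F) {a : ℝ} (ha : 0 < a) (k : ℕ) {y : ℝ} (hy : 0 < y) :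
    HasDerivAt (slope F a k) (slope F a (k + 1) y) y := by
  -- all segments from `a` to a point near `y` stay in a compact interval `[m, B]` of `(0, ∞)`
  set m := min a (y / 2) with hm
  set B := max a (2 * y) with hB
  have hm0 : 0 < m := lt_min ha (by positivity)
  have hcomp : IsCompact (Icc m B) := isCompact_Icc
  have hsub : Icc m B ⊆ Ioi 0 := fun z hz => lt_of_lt_of_le hm0 hz.1
  obtain ⟨C, hC⟩ := hcomp.exists_bound_of_continuousOn ((hF.continuousOn (k + 2)).mono hsub)
  have hball : ∀ x ∈ Ioo (y / 2) (2 * y), ∀ s ∈ Icc (0 : ℝ) 1, a + s * (x - a) ∈ Icc m B := by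
    intro x hx s hs
    have h1 : m ≤ a := min_le_left _ _
    have h2 : m ≤ x := (min_le_right _ _).trans hx.1.le
    have h3 : a ≤ B := le_max_left _ _
    have h4 : x ≤ B := hx.2.le.trans (le_max_right _ _)
    obtain ⟨h0, h1'⟩ := hs
    constructor <;> nlinarith [mul_nonneg h0 (sub_nonneg.2 h2), mul_nonneg (sub_nonneg.2 h1')
      (sub_nonneg.2 h1), mul_nonneg h0 (sub_nonneg.2 h4), mul_nonneg (sub_nonneg.2 h1')
      (sub_nonneg.2 h3)]
  have hnhds : Ioo (y / 2) (2 * y) ∈ nhds y := Ioo_mem_nhds (by linarith) (by linarith)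
  have hx0 : ∀ x ∈ Ioo (y / 2) (2 * y), 0 < x := fun x hx => lt_trans (by positivity) hx.1
  have hint : ∀ x, 0 < x → ∀ i l : ℕ,
      IntervalIntegrable (fun s : ℝ => s ^ l * F i (a + s * (x - a))) volume 0 1 := by
    intro x hx i l
    refine ContinuousOn.intervalIntegrable ?_
    rw [uIcc_of_le zero_le_one]
    exact hF.continuousOn_segment ha hx i l
  have key := intervalIntegral.hasDerivAt_integral_of_dominated_loc_of_deriv_le
    (μ := volume) (a := (0 : ℝ)) (b := 1) (s := Ioo (y / 2) (2 * y)) (x₀ := y)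
    (F := fun x s => s ^ k * F (k + 1) (a + s * (x - a)))
    (F' := fun x s => s ^ (k + 1) * F (k + 2) (a + s * (x - a)))
    (bound := fun _ => C) hnhds
    (by
      filter_upwards [hnhds] with x hx
      exact (hint x (hx0 x hx) _ _).def'.aestronglyMeasurable)
    (hint y hy _ _)
    ((hint y hy _ _).def'.aestronglyMeasurable)
    (by
      refine Eventually.of_forall fun s hs x hx => ?_
      rw [uIoc_of_le zero_le_one] at hs
      have hs' : s ∈ Icc (0 : ℝ) 1 := ⟨hs.1.le, hs.2⟩
      have h1 := hC _ (hball x hx s hs')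
      rw [norm_mul]
      have h2 : ‖s ^ (k + 1)‖ ≤ 1 := by
        rw [norm_pow, Real.norm_of_nonneg hs.1.le]
        exact pow_le_one₀ hs.1.le hs.2
      calc _ ≤ 1 * C := mul_le_mul h2 h1 (norm_nonneg _) zero_le_one
        _ = C := one_mul C)
    (intervalIntegrable_const)
    (by
      refine Eventually.of_forall fun s hs x hx => ?_
      rw [uIoc_of_le zero_le_one] at hs
      have hs' : s ∈ Icc (0 : ℝ) 1 := ⟨hs.1.le, hs.2⟩
      have h1 := hF.hasDerivAt (k + 1) _ (segment_pos ha (hx0 x hx) hs')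
      have h2 : HasDerivAt (fun x : ℝ => a + s * (x - a)) s x := by
        simpa using (((hasDerivAt_id x).sub_const a).const_mul s).const_add a
      have h3 := (h1.comp x h2).const_mul (s ^ k)
      exact h3.congr_deriv (by ring))
  exact key.2.neg

theorem isCMTower_slope (hF : IsCMTower F) {a : ℝ} (ha : 0 < a) : IsCMTower (slope F a) := by
  refine ⟨fun k y hy => hF.hasDerivAt_slope ha k hy, fun k y hy => ?_⟩
  rw [slope, mul_neg, ← intervalIntegral.integral_const_mul, ← intervalIntegral.integral_neg]
  refine intervalIntegral.integral_nonneg zero_le_one fun s hs => ?_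
  have h1 := hF.sign (k + 1) _ (segment_pos ha hy hs)
  have h2 : 0 ≤ s ^ k := pow_nonneg hs.1 k
  have := mul_nonneg h2 h1
  rw [pow_succ] at this
  linarith

/-- Newton interpolation of a completely monotonic function: in the basis `∏ (a i - y)` all
coefficients are nonnegative, and the remainder is again the product of the factors `a i - y` with
a completely monotonic function. -/
theorem exists_newton (hF : IsCMTower F) (a : ℕ → ℝ) (n : ℕ) (ha : ∀ i < n, 0 < a i) :
    ∃ (c : ℕ → ℝ) (G : ℕ → ℝ → ℝ), (∀ j, 0 ≤ c j) ∧ IsCMTower G ∧ ∀ y, 0 < y →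
      F 0 y = ∑ j ∈ Finset.range n, c j * ∏ i ∈ Finset.range j, (a i - y)
        + (∏ i ∈ Finset.range n, (a i - y)) * G 0 y := by
  induction n with
  | zero => exact ⟨fun _ => 0, F, fun _ => le_rfl, hF, fun y _ => by simp⟩
  | succ n ih =>
    obtain ⟨c, G, hc, hG, h⟩ := ih fun i hi => ha i (hi.trans n.lt_succ_self)
    have han := ha n n.lt_succ_self
    refine ⟨fun j => if j < n then c j else G 0 (a n), slope G (a n), fun j => ?_,
      hG.isCMTower_slope han, fun y hy => ?_⟩
    · dsimp only
      split_ifs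
      exacts [hc j, hG.nonneg han]
    · rw [h y hy, hG.slope_zero_mul han hy, Finset.sum_range_succ, Finset.prod_range_succ]
      have : ∑ j ∈ Finset.range n, (if j < n then c j else G 0 (a n)) *
          ∏ i ∈ Finset.range j, (a i - y) = ∑ j ∈ Finset.range n, c j *
          ∏ i ∈ Finset.range j, (a i - y) :=
        Finset.sum_congr rfl fun j hj => by rw [if_pos (Finset.mem_range.1 hj)]
      simp only [this, if_neg (lt_irrefl n)]
      ring

end IsCMTower

/-! ### Cosine polynomials with nonnegative coefficients -/

/-- A cosine polynomial of degree at most `d` with nonnegative coefficients. -/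
def IsCosSum (d : ℕ) (H : ℝ → ℝ) : Prop :=
  ∃ b : ℕ → ℝ, (∀ l, 0 ≤ b l) ∧
    ∀ θ, H θ = ∑ l ∈ Finset.range (d + 1), b l * Real.cos (l * θ)

namespace IsCosSum

variable {d e : ℕ} {G H : ℝ → ℝ}

theorem cos {l : ℕ} (h : l ≤ d) : IsCosSum d fun θ => Real.cos (l * θ) :=
  ⟨fun i => if i = l then 1 else 0, fun i => by dsimp only; split_ifs <;> norm_num, fun θ => by
    simp [Nat.lt_succ_of_le h]⟩

theorem zero : IsCosSum d fun _ => 0 := ⟨fun _ => 0, fun _ => le_rfl, fun θ => by simp⟩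

theorem add (hG : IsCosSum d G) (hH : IsCosSum d H) : IsCosSum d fun θ => G θ + H θ := by
  obtain ⟨b, hb, hb'⟩ := hG
  obtain ⟨c, hc, hc'⟩ := hH
  refine ⟨fun l => b l + c l, fun l => add_nonneg (hb l) (hc l), fun θ => ?_⟩
  simp only [hb', hc', ← Finset.sum_add_distrib]
  exact Finset.sum_congr rfl fun _ _ => by ring

theorem const_mul {r : ℝ} (hr : 0 ≤ r) (hH : IsCosSum d H) : IsCosSum d fun θ => r * H θ := by
  obtain ⟨b, hb, hb'⟩ := hH
  refine ⟨fun l => r * b l, fun l => mul_nonneg hr (hb l), fun θ => ?_⟩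
  simp only [hb', Finset.mul_sum]
  exact Finset.sum_congr rfl fun _ _ => by ring

theorem sum {ι : Type*} {s : Finset ι} {H : ι → ℝ → ℝ} (h : ∀ i ∈ s, IsCosSum d (H i)) :
    IsCosSum d fun θ => ∑ i ∈ s, H i θ := by
  classical
  induction s using Finset.induction_on with
  | empty => simpa using zero
  | insert i s hi ih =>
    simp only [Finset.sum_insert hi]
    exact (h i (Finset.mem_insert_self i s)).add
      (ih fun j hj => h j (Finset.mem_insert_of_mem hj))

theorem mono (hH : IsCosSum d H) (h : d ≤ e) : IsCosSum e H := by
  obtain ⟨b, hb, hb'⟩ := hH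
  rw [funext hb']
  exact sum fun l hl => const_mul (hb l) (cos ((Nat.lt_succ_iff.1 (Finset.mem_range.1 hl)).trans h))

theorem cos_mul_cos {i j : ℕ} (h : i + j ≤ d) :
    IsCosSum d fun θ => Real.cos (i * θ) * Real.cos (j * θ) := by
  wlog hij : j ≤ i generalizing i j
  · simpa only [mul_comm] using this ((add_comm j i).trans_le h) (le_of_not_ge hij)
  have : (fun θ => Real.cos (i * θ) * Real.cos (j * θ)) = fun θ =>
      1 / 2 * Real.cos ((i + j : ℕ) * θ) + 1 / 2 * Real.cos ((i - j : ℕ) * θ) := by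
    funext θ
    push_cast [hij]
    rw [add_mul, sub_mul, Real.cos_add, Real.cos_sub]
    ring
  rw [this]
  exact (const_mul (by norm_num) (cos h)).add (const_mul (by norm_num) (cos (by omega)))

theorem mul (hG : IsCosSum d G) (hH : IsCosSum e H) : IsCosSum (d + e) fun θ => G θ * H θ := by
  obtain ⟨b, hb, hb'⟩ := hG
  obtain ⟨c, hc, hc'⟩ := hH
  have : (fun θ => G θ * H θ) = fun θ => ∑ i ∈ Finset.range (d + 1), ∑ j ∈ Finset.range (e + 1),
      (b i * c j) * (Real.cos (i * θ) * Real.cos (j * θ)) := by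
    funext θ
    rw [hb', hc', Finset.sum_mul_sum]
    exact Finset.sum_congr rfl fun i _ => Finset.sum_congr rfl fun j _ => by ring
  rw [this]
  refine sum fun i hi => sum fun j hj => const_mul (mul_nonneg (hb i) (hc j)) (cos_mul_cos ?_)
  have := Finset.mem_range.1 hi
  have := Finset.mem_range.1 hj
  omega

end IsCosSum

/-- The `q`-binomial coefficient of `r` over `k` at `q = exp (2 i φ)`, normalized so as to be
real. -/
def sinBinom (φ : ℝ) (r k : ℕ) : ℝ :=
  ∏ i ∈ Finset.range k, Real.sin (((r : ℝ) - i) * φ) / Real.sin ((i + 1) * φ)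

theorem sinBinom_nonneg {φ : ℝ} (hφ : 0 < φ) {r : ℕ} (hr : r * φ ≤ Real.pi) {k : ℕ} (hk : k ≤ r) :
    0 ≤ sinBinom φ r k := by
  refine Finset.prod_nonneg fun i hi => ?_
  have hi' : ((i : ℝ) + 1) ≤ r := by
    exact_mod_cast (Nat.succ_le_of_lt (Finset.mem_range.1 hi)).trans hk
  have hi0 : (0 : ℝ) ≤ i := Nat.cast_nonneg i
  refine div_nonneg (Real.sin_nonneg_of_nonneg_of_le_pi ?_ ?_)
    (Real.sin_nonneg_of_nonneg_of_le_pi ?_ ?_) <;> nlinarith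

theorem sinBinom_succ_right (φ : ℝ) (r k : ℕ) : sinBinom φ r (k + 1) =
    sinBinom φ r k * (Real.sin (((r : ℝ) - k) * φ) / Real.sin ((k + 1) * φ)) :=
  Finset.prod_range_succ _ _

theorem sinBinom_succ_succ (φ : ℝ) (r k : ℕ) : sinBinom φ (r + 1) (k + 1) =
    sinBinom φ r k * (Real.sin ((r + 1) * φ) / Real.sin ((k + 1) * φ)) := by
  induction k with
  | zero => simp [sinBinom]
  | succ k ih =>
    rw [sinBinom_succ_right, ih, sinBinom_succ_right]
    push_cast
    rw [show (r : ℝ) + 1 - (k + 1) = r - k by ring]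
    ring

theorem sinBinom_self_succ (φ : ℝ) (r : ℕ) : sinBinom φ r (r + 1) = 0 := by
  simp [sinBinom_succ_right]

open Complex in
/-- The Pascal rule for `sinBinom`, with `α = exp (i φ)`. -/
theorem sinBinom_pascal {φ : ℝ} (r k : ℕ) (h : Real.sin ((k + 1) * φ) ≠ 0) :
    (sinBinom φ (r + 1) (k + 1) : ℂ) = cexp (((k : ℂ) - r) * φ * I) * sinBinom φ r k
      + cexp ((k + 1) * φ * I) * sinBinom φ r (k + 1) := by
  have key : (Real.sin ((r + 1) * φ) : ℂ) = cexp (((k : ℂ) - r) * φ * I) * Real.sin ((k + 1) * φ)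
      + cexp ((k + 1) * φ * I) * Real.sin (((r : ℝ) - k) * φ) := by
    rw [show ((r : ℝ) + 1) * φ = (k + 1) * φ + (r - k) * φ by ring, Real.sin_add]
    have e1 : cexp (((k : ℂ) - r) * φ * I) =
        Real.cos (((r : ℝ) - k) * φ) - Real.sin (((r : ℝ) - k) * φ) * I := by
      rw [show ((k : ℂ) - r) * φ * I = ((-((r - k) * φ) : ℝ) : ℂ) * I by push_cast; ring,
        Complex.exp_mul_I, ← ofReal_cos, ← ofReal_sin, Real.cos_neg, Real.sin_neg]
      push_cast; ring
    have e2 : cexp (((k : ℂ) + 1) * φ * I) =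
        Real.cos (((k : ℝ) + 1) * φ) + Real.sin (((k : ℝ) + 1) * φ) * I := by
      rw [show ((k : ℂ) + 1) * φ * I = (((k + 1) * φ : ℝ) : ℂ) * I by push_cast; ring,
        Complex.exp_mul_I, ← ofReal_cos, ← ofReal_sin]
    rw [e1, e2]
    push_cast
    ring
  have h' : (Real.sin ((k + 1) * φ) : ℂ) ≠ 0 := by exact_mod_cast h
  rw [sinBinom_succ_succ, sinBinom_succ_right]
  simp only [ofReal_mul, ofReal_div]
  rw [key]
  field_simp

open Complex in
/-- The `q`-binomial theorem for `r` consecutive points on the unit circle, in symmetric position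
about `-1`. -/
theorem prod_add_exp_eq_sum_sinBinom {φ : ℝ} (r : ℕ)
    (h : ∀ k < r, Real.sin ((k + 1) * φ) ≠ 0) (z : ℂ) :
    ∏ l ∈ Finset.range r, (z + cexp ((2 * l - r + 1) * φ * I)) =
      ∑ k ∈ Finset.range (r + 1), (sinBinom φ r k : ℂ) * z ^ k := by
  induction r generalizing z with
  | zero => simp [sinBinom]
  | succ r ih =>
    have hE : ∀ s t : ℂ, cexp (s * φ * I) * cexp (t * φ * I) = cexp ((s + t) * φ * I) :=
      fun s t => by rw [← Complex.exp_add]; ring_nf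
    have hpow : ∀ (s : ℂ) (n : ℕ), cexp (s * φ * I) ^ n = cexp ((n * s) * φ * I) :=
      fun s n => by rw [← Complex.exp_nat_mul]; ring_nf
    have hprod : ∏ l ∈ Finset.range r, (z + cexp ((2 * l - (r + 1 : ℕ) + 1) * φ * I)) =
        cexp (-1 * φ * I) ^ r *
          ∏ l ∈ Finset.range r, (cexp (1 * φ * I) * z + cexp ((2 * l - r + 1) * φ * I)) := by
      rw [← Finset.card_range r, ← Finset.prod_const, Finset.card_range,
        ← Finset.prod_mul_distrib]
      refine Finset.prod_congr rfl fun l _ => ?_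
      rw [mul_add, ← mul_assoc, hE, hE]
      push_cast
      ring_nf
      simp
    have hlast : (2 * (r : ℂ) - (r + 1 : ℕ) + 1) = r := by push_cast; ring
    rw [Finset.prod_range_succ, hprod, hlast, ih fun k hk => h k (hk.trans r.lt_succ_self)]
    have hR : ∑ k ∈ Finset.range (r + 1 + 1), (sinBinom φ (r + 1) k : ℂ) * z ^ k =
        ∑ k ∈ Finset.range (r + 1), cexp (((k : ℂ) - r) * φ * I) * sinBinom φ r k * z ^ (k + 1) +
        ∑ k ∈ Finset.range (r + 1), cexp (k * φ * I) * sinBinom φ r k * z ^ k := by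
      have h1 : ∑ k ∈ Finset.range (r + 1), cexp (k * φ * I) * sinBinom φ r k * z ^ k =
          ∑ k ∈ Finset.range (r + 1 + 1), cexp (k * φ * I) * sinBinom φ r k * z ^ k := by
        rw [Finset.sum_range_succ _ (r + 1), sinBinom_self_succ]
        simp
      rw [h1, Finset.sum_range_succ', Finset.sum_range_succ' _ (r + 1), ← add_assoc,
        ← Finset.sum_add_distrib]
      congr 1
      · refine Finset.sum_congr rfl fun k hk => ?_
        rw [sinBinom_pascal r k (h k (Finset.mem_range.1 hk))]
        push_cast
        ring
      · simp [sinBinom]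
    rw [hR, Finset.mul_sum, Finset.sum_mul, ← Finset.sum_add_distrib]
    refine Finset.sum_congr rfl fun k _ => ?_
    have e1 : cexp (((k : ℂ) - r) * φ * I) = cexp (-1 * φ * I) ^ r * cexp (1 * φ * I) ^ k := by
      rw [hpow, hpow, hE]; ring_nf
    have e2 : cexp ((k : ℂ) * φ * I) =
        cexp (-1 * φ * I) ^ r * cexp (1 * φ * I) ^ k * cexp (r * φ * I) := by
      rw [← e1, hE]; ring_nf
    rw [e1, e2]
    ring

open Complex in
/-- The roots `-exp (± i (2 i + 1) φ)` are consecutive and symmetric about `-1`, so the coefficients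
are the numbers `sinBinom`. -/
theorem isCosSum_prod_cos_add_cos {φ : ℝ} (hφ : 0 < φ) {m : ℕ} (hm : 2 * m * φ < Real.pi) :
    IsCosSum m fun θ =>
      ∏ i ∈ Finset.range m, (2 * (Real.cos θ + Real.cos ((2 * i + 1) * φ))) := by
  have hsin : ∀ k < 2 * m, Real.sin (((k : ℝ) + 1) * φ) ≠ 0 := by
    intro k hk
    have hk' : ((k : ℝ) + 1) ≤ 2 * m := by exact_mod_cast Nat.succ_le_of_lt hk
    exact (Real.sin_pos_of_pos_of_lt_pi (by positivity) (by nlinarith)).ne'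
  have key : ∀ θ : ℝ, ∏ i ∈ Finset.range m, (2 * (Real.cos θ + Real.cos ((2 * i + 1) * φ))) =
      ∑ k ∈ Finset.range (2 * m + 1), sinBinom φ (2 * m) k * Real.cos (((k : ℝ) - m) * θ) := by
    intro θ
    have h1 := prod_add_exp_eq_sum_sinBinom (2 * m) hsin (cexp (θ * I))
    -- pair each factor with its mirror image; the pair is `z (z + z⁻¹ + 2 cos ((2 i + 1) φ))`
    have h2 : ∏ l ∈ Finset.range (2 * m),
        (cexp (θ * I) + cexp ((2 * l - (2 * m : ℕ) + 1) * φ * I)) =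
        cexp (θ * I) ^ m *
          ∏ i ∈ Finset.range m, ((2 * (Real.cos θ + Real.cos ((2 * i + 1) * φ)) : ℝ) : ℂ) := by
      rw [two_mul m, Finset.prod_range_add, ← Finset.prod_range_reflect, ← Finset.prod_mul_distrib,
        ← Finset.card_range m, ← Finset.prod_const, Finset.card_range, ← Finset.prod_mul_distrib]
      refine Finset.prod_congr rfl fun i hi => ?_
      have hi' : i + 1 ≤ m := Finset.mem_range.1 hi
      have e1 : (2 * ((m - 1 - i : ℕ) : ℂ) - (m + m : ℕ) + 1) * φ * I =
          -(((2 * i + 1) * φ : ℝ) : ℂ) * I := by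
        rw [Nat.sub_sub, Nat.cast_sub (by omega)]
        push_cast; ring
      have e2 : (2 * ((m + i : ℕ) : ℂ) - (m + m : ℕ) + 1) * φ * I =
          (((2 * i + 1) * φ : ℝ) : ℂ) * I := by
        push_cast; ring
      rw [e1, e2]
      generalize (2 * (i : ℝ) + 1) * φ = β
      push_cast
      simp only [Complex.cos]
      have z1 : cexp (θ * I) * cexp (-θ * I) = 1 := by rw [← Complex.exp_add]; simp
      have z2 : cexp (-β * I) * cexp (β * I) = 1 := by rw [← Complex.exp_add]; simp
      linear_combination z2 - z1
    rw [h2] at h1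
    have h3 := congrArg (fun w : ℂ => (cexp (-(θ * I)) ^ m * w).re) h1
    rw [← mul_assoc, ← mul_pow, ← Complex.exp_add, neg_add_cancel, Complex.exp_zero, one_pow,
      one_mul, ← ofReal_prod, ofReal_re] at h3
    rw [h3, Finset.mul_sum, Complex.re_sum]
    refine Finset.sum_congr rfl fun k _ => ?_
    have : cexp (-(θ * I)) ^ m * ((sinBinom φ (2 * m) k : ℂ) * cexp (θ * I) ^ k) =
        (sinBinom φ (2 * m) k : ℂ) * cexp ((((k - m) * θ : ℝ) : ℂ) * I) := by
      rw [← Complex.exp_nat_mul, ← Complex.exp_nat_mul, mul_left_comm, ← Complex.exp_add]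
      push_cast
      ring_nf
    rw [this, re_ofReal_mul, Complex.exp_ofReal_mul_I_re]
  rw [funext key]
  refine IsCosSum.sum fun k hk => IsCosSum.const_mul
    (sinBinom_nonneg hφ (by push_cast; exact hm.le) (Nat.lt_succ_iff.1 (Finset.mem_range.1 hk))) ?_
  have hk' := Finset.mem_range.1 hk
  rcases le_total m k with h | h
  · have := IsCosSum.cos (d := m) (l := k - m) (by omega)
    simpa only [Nat.cast_sub h] using this
  · have := IsCosSum.cos (d := m) (l := m - k) (by omega)
    have e : ∀ θ : ℝ, Real.cos (((k : ℝ) - m) * θ) = Real.cos (((m - k : ℕ) : ℝ) * θ) := fun θ => by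
      rw [Nat.cast_sub h, ← Real.cos_neg]; ring_nf
    simpa only [e] using this

/-! ### Interpolation on a circle of circumference `2 N + 1` -/

/-- The squared chord length between two points at arc distance `x` on a circle of circumference
`2 N + 1`. -/
def chordSq (N : ℕ) (x : ℝ) : ℝ :=
  ((2 * N + 1) / Real.pi) ^ 2 * Real.sin (Real.pi * x / (2 * N + 1)) ^ 2

/-- The derivative of `chordSq N`. -/
def chordSqDeriv (N : ℕ) (x : ℝ) : ℝ :=
  (2 * N + 1) / Real.pi * Real.sin (2 * Real.pi * x / (2 * N + 1))

theorem hasDerivAt_chordSq (N : ℕ) (x : ℝ) : HasDerivAt (chordSq N) (chordSqDeriv N x) x := by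
  have hM : (0 : ℝ) < 2 * N + 1 := by positivity
  have h1 : HasDerivAt (fun x : ℝ => Real.pi * x / (2 * N + 1)) (Real.pi / (2 * N + 1)) x := by
    simpa using ((hasDerivAt_id x).const_mul Real.pi).div_const (2 * (N : ℝ) + 1)
  refine ((h1.sin.pow 2).const_mul (((2 * N + 1) / Real.pi) ^ 2)).congr_deriv ?_
  rw [chordSqDeriv, show 2 * Real.pi * x / (2 * N + 1) = 2 * (Real.pi * x / (2 * N + 1)) by ring,
    Real.sin_two_mul]
  field_simp
  ring

theorem chordSq_eq_cos (N : ℕ) (x : ℝ) : chordSq N x =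
    ((2 * N + 1) / Real.pi) ^ 2 / 2 * (1 - Real.cos (2 * Real.pi * x / (2 * N + 1))) := by
  rw [chordSq, show 2 * Real.pi * x / (2 * N + 1) = 2 * (Real.pi * x / (2 * N + 1)) by ring,
    Real.sin_sq_eq_half_sub]
  ring

theorem chordSq_reflect (N : ℕ) (x : ℝ) : chordSq N (2 * N + 1 - x) = chordSq N x := by
  have hM : (0 : ℝ) < 2 * N + 1 := by positivity
  rw [chordSq, chordSq, show Real.pi * (2 * N + 1 - x) / (2 * N + 1) =
    Real.pi - Real.pi * x / (2 * N + 1) by field_simp, Real.sin_pi_sub]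

theorem chordSqDeriv_reflect (N : ℕ) (x : ℝ) :
    chordSqDeriv N (2 * N + 1 - x) = -chordSqDeriv N x := by
  have hM : (0 : ℝ) < 2 * N + 1 := by positivity
  rw [chordSqDeriv, chordSqDeriv, show 2 * Real.pi * (2 * N + 1 - x) / (2 * N + 1) =
    2 * Real.pi - 2 * Real.pi * x / (2 * N + 1) by field_simp, Real.sin_two_pi_sub]
  ring

theorem chordSq_pos {N : ℕ} {x : ℝ} (h0 : 0 < x) (h1 : x < 2 * N + 1) : 0 < chordSq N x := by
  have hM : (0 : ℝ) < 2 * N + 1 := by positivity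
  have := Real.sin_pos_of_pos_of_lt_pi (x := Real.pi * x / (2 * N + 1)) (by positivity)
    (by rw [div_lt_iff₀ hM]; exact mul_lt_mul_of_pos_left h1 Real.pi_pos)
  unfold chordSq
  positivity

open Complex in
theorem sum_cos_eq_zero {M : ℕ} (a : ℤ) (h : ¬ (M : ℤ) ∣ a) :
    ∑ k ∈ Finset.range M, Real.cos (2 * Real.pi * (a * k) / M) = 0 := by
  rcases Nat.eq_zero_or_pos M with rfl | hM
  · simp
  have hM' : (M : ℂ) ≠ 0 := by exact_mod_cast hM.ne'
  set ζ := cexp (2 * Real.pi * I / M) with hζ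
  have hprim : IsPrimitiveRoot ζ M := Complex.isPrimitiveRoot_exp M hM.ne'
  have h1 : ζ ^ a ≠ 1 := fun h' => h ((hprim.zpow_eq_one_iff_dvd a).1 h')
  have h2 : (ζ ^ a) ^ M = 1 := by
    rw [← zpow_natCast, ← zpow_mul, mul_comm, zpow_mul, zpow_natCast, hprim.pow_eq_one, one_zpow]
  have h3 : ∑ k ∈ Finset.range M, (ζ ^ a) ^ k = 0 := by
    rw [geom_sum_eq h1, h2]; simp
  have h4 := congrArg Complex.re h3
  rw [Complex.re_sum, Complex.zero_re] at h4
  rw [← h4]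
  refine Finset.sum_congr rfl fun k _ => ?_
  rw [← zpow_natCast, ← zpow_mul, hζ, ← Complex.exp_int_mul]
  rw [show ((a * (k : ℤ) : ℤ) : ℂ) * (2 * Real.pi * I / M) =
    ((2 * Real.pi * (a * k) / M : ℝ) : ℂ) * I by push_cast; field_simp, Complex.exp_ofReal_mul_I_re]

theorem sum_cos_eq_card {M : ℕ} (a : ℤ) (h : (M : ℤ) ∣ a) :
    ∑ k ∈ Finset.range M, Real.cos (2 * Real.pi * (a * k) / M) = M := by
  rcases Nat.eq_zero_or_pos M with rfl | hM
  · simp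
  obtain ⟨c, rfl⟩ := h
  have hM' : (M : ℝ) ≠ 0 := by exact_mod_cast hM.ne'
  have : ∀ k ∈ Finset.range M, Real.cos (2 * Real.pi * (((M * c : ℤ) : ℝ) * k) / M) = 1 := by
    intro k _
    rw [show 2 * Real.pi * (((M * c : ℤ) : ℝ) * k) / M = ((c * k : ℤ) : ℝ) * (2 * Real.pi) by
      push_cast; field_simp]
    exact Real.cos_int_mul_two_pi _
  rw [Finset.sum_congr rfl this]
  simp

/-- From the values `u` and the derivatives `v` of a cosine polynomial at the integers modulo `M`,
its `j`-th coefficient up to normalization. It separates the frequencies `j` and `M - j`, which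
the values alone confuse. -/
def circleCoeff (M : ℕ) (j : ℕ) (u v : ℕ → ℝ) : ℝ :=
  (1 - (j : ℝ) / M) * ∑ k ∈ Finset.range M, u k * Real.cos (2 * Real.pi * (j * k) / M)
    - 1 / (2 * Real.pi) * ∑ k ∈ Finset.range M, v k * Real.sin (2 * Real.pi * (j * k) / M)

theorem circleCoeff_cos {M j l : ℕ} (hj : j < M) (hl : l < M) :
    circleCoeff M j (fun k => Real.cos (2 * Real.pi * (l * k) / M))
      (fun k => -(2 * Real.pi * l / M) * Real.sin (2 * Real.pi * (l * k) / M)) =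
    if l = j then (if j = 0 then (M : ℝ) else M / 2) else 0 := by
  have hM : (0 : ℝ) < M := by exact_mod_cast (Nat.zero_le j).trans_lt hj
  set c : ℤ → ℝ := fun a => ∑ k ∈ Finset.range M, Real.cos (2 * Real.pi * (a * k) / M) with hc
  have h1 : ∑ k ∈ Finset.range M, Real.cos (2 * Real.pi * (l * k) / M) *
      Real.cos (2 * Real.pi * (j * k) / M) = (c (l - j) + c (l + j)) / 2 := by
    simp only [hc, ← Finset.sum_add_distrib, Finset.sum_div]
    refine Finset.sum_congr rfl fun k _ => ?_
    push_cast
    rw [show 2 * Real.pi * (((l : ℝ) - j) * k) / M = 2 * Real.pi * (l * k) / M -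
      2 * Real.pi * (j * k) / M by ring, show 2 * Real.pi * (((l : ℝ) + j) * k) / M =
      2 * Real.pi * (l * k) / M + 2 * Real.pi * (j * k) / M by ring, Real.cos_sub, Real.cos_add]
    ring
  have h2 : ∑ k ∈ Finset.range M, -(2 * Real.pi * l / M) * Real.sin (2 * Real.pi * (l * k) / M) *
      Real.sin (2 * Real.pi * (j * k) / M) =
      -(2 * Real.pi * l / M) * ((c (l - j) - c (l + j)) / 2) := by
    simp only [hc, ← Finset.sum_sub_distrib, Finset.sum_div, Finset.mul_sum]
    refine Finset.sum_congr rfl fun k _ => ?_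
    push_cast
    rw [show 2 * Real.pi * (((l : ℝ) - j) * k) / M = 2 * Real.pi * (l * k) / M -
      2 * Real.pi * (j * k) / M by ring, show 2 * Real.pi * (((l : ℝ) + j) * k) / M =
      2 * Real.pi * (l * k) / M + 2 * Real.pi * (j * k) / M by ring, Real.cos_sub, Real.cos_add]
    ring
  have h3 : circleCoeff M j (fun k => Real.cos (2 * Real.pi * (l * k) / M))
      (fun k => -(2 * Real.pi * l / M) * Real.sin (2 * Real.pi * (l * k) / M)) =
      ((1 + ((l : ℝ) - j) / M) * c (l - j) + (1 - ((l : ℝ) + j) / M) * c (l + j)) / 2 := by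
    rw [circleCoeff, h1, h2]
    field_simp
    ring
  rw [h3]
  have hc0 : ∀ a : ℤ, ¬ (M : ℤ) ∣ a → c a = 0 := fun a ha => sum_cos_eq_zero a ha
  have hcM : ∀ a : ℤ, (M : ℤ) ∣ a → c a = M := fun a ha => sum_cos_eq_card a ha
  -- when `l + j = M`, the factor `1 - (l + j) / M` vanishes
  have hplus : (1 - ((l : ℝ) + j) / M) * c (l + j) = if l = 0 ∧ j = 0 then (M : ℝ) else 0 := by
    split_ifs with h
    · obtain ⟨rfl, rfl⟩ := h
      rw [hcM _ (by simp)]; simp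
    · by_cases hd : (M : ℤ) ∣ l + j
      · have : l + j = M := by
          obtain ⟨e, he⟩ := hd
          have he1 : 0 < e := by
            by_contra! hcon
            have : (M : ℤ) * e ≤ 0 := mul_nonpos_of_nonneg_of_nonpos (by positivity) hcon
            omega
          have he2 : e < 2 := by
            by_contra! hcon
            have : (M : ℤ) * 2 ≤ M * e := mul_le_mul_of_nonneg_left hcon (by positivity)
            omega
          obtain rfl : e = 1 := by omega
          omega
        rw [show ((l : ℝ) + j) = M by exact_mod_cast this, div_self hM.ne']
        simp
      · rw [hc0 _ hd, mul_zero]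
  have hminus : (1 + ((l : ℝ) - j) / M) * c (l - j) = if l = j then (M : ℝ) else 0 := by
    split_ifs with h
    · subst h
      rw [hcM _ (by simp)]; simp
    · rw [hc0, mul_zero]
      intro hd
      have := Int.eq_zero_of_abs_lt_dvd hd (by rw [abs_lt]; omega)
      omega
  rw [hplus, hminus]
  by_cases h1 : l = j
  · subst h1
    by_cases h2 : l = 0 <;> simp [h2]
  · have : ¬ (l = 0 ∧ j = 0) := by omega
    simp [h1, this]

/-- The coefficients of a cosine polynomial of degree less than `M` can be read off from its values
and derivatives at the integers modulo `M`. -/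
theorem circleCoeff_sum {M j : ℕ} (hj : j < M) (b : ℕ → ℝ) (u v : ℕ → ℝ)
    (hu : ∀ k, u k = ∑ l ∈ Finset.range M, b l * Real.cos (2 * Real.pi * (l * k) / M))
    (hv : ∀ k, v k = ∑ l ∈ Finset.range M,
      b l * (-(2 * Real.pi * l / M) * Real.sin (2 * Real.pi * (l * k) / M))) :
    circleCoeff M j u v = b j * if j = 0 then (M : ℝ) else M / 2 := by
  have h : circleCoeff M j u v = ∑ l ∈ Finset.range M, b l *
      circleCoeff M j (fun k => Real.cos (2 * Real.pi * (l * k) / M))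
      (fun k => -(2 * Real.pi * l / M) * Real.sin (2 * Real.pi * (l * k) / M)) := by
    have e1 : ∑ k ∈ Finset.range M, u k * Real.cos (2 * Real.pi * (j * k) / M) =
        ∑ l ∈ Finset.range M, b l * ∑ k ∈ Finset.range M,
          Real.cos (2 * Real.pi * (l * k) / M) * Real.cos (2 * Real.pi * (j * k) / M) := by
      simp only [hu, Finset.sum_mul, Finset.mul_sum]
      rw [Finset.sum_comm]
      exact Finset.sum_congr rfl fun _ _ => Finset.sum_congr rfl fun _ _ => by ring
    have e2 : ∑ k ∈ Finset.range M, v k * Real.sin (2 * Real.pi * (j * k) / M) =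
        ∑ l ∈ Finset.range M, b l * ∑ k ∈ Finset.range M,
          -(2 * Real.pi * l / M) * Real.sin (2 * Real.pi * (l * k) / M) *
            Real.sin (2 * Real.pi * (j * k) / M) := by
      simp only [hv, Finset.sum_mul, Finset.mul_sum]
      rw [Finset.sum_comm]
      exact Finset.sum_congr rfl fun _ _ => Finset.sum_congr rfl fun _ _ => by ring
    rw [circleCoeff, e1, e2, Finset.mul_sum, Finset.mul_sum, ← Finset.sum_sub_distrib]
    refine Finset.sum_congr rfl fun l _ => ?_
    rw [circleCoeff]
    ring
  rw [h, Finset.sum_congr rfl fun l hl => by rw [circleCoeff_cos hj (Finset.mem_range.1 hl)]]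
  simp [hj]

theorem sum_range_fold (N : ℕ) (u : ℕ → ℝ) (hu : ∀ k, 1 ≤ k → k ≤ N → u (2 * N + 1 - k) = u k) :
    ∑ k ∈ Finset.range (2 * N + 1), u k = u 0 + 2 * ∑ k ∈ Finset.range N, u (k + 1) := by
  rw [Finset.sum_range_succ', two_mul N, Finset.sum_range_add, ← Finset.sum_range_reflect
    (fun x => u (N + x + 1))]
  have : ∀ k ∈ Finset.range N, u (N + (N - 1 - k) + 1) = u (k + 1) := by
    intro k hk
    have := Finset.mem_range.1 hk
    rw [← hu (k + 1) (by omega) (by omega)]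
    congr 1
    omega
  rw [Finset.sum_congr rfl this]
  ring

theorem prod_range_two_mul_div_two (g : ℕ → ℝ) (m : ℕ) :
    ∏ i ∈ Finset.range (2 * m), g (i / 2) = (∏ i ∈ Finset.range m, g i) ^ 2 := by
  induction m with
  | zero => simp
  | succ m ih =>
    rw [show 2 * (m + 1) = 2 * m + 1 + 1 by ring, Finset.prod_range_succ, Finset.prod_range_succ,
      Finset.prod_range_succ, ih, show 2 * m / 2 = m by omega, show (2 * m + 1) / 2 = m by omega]
    ring

/-- Every node occurs twice, so the product of the first `j` factors is, up to a positive constant,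
the square of a product as in `isCosSum_prod_cos_add_cos` or the product of two consecutive ones. -/
theorem isCosSum_partialProd {N j : ℕ} (hj : j < 2 * N) :
    IsCosSum j fun θ => ∏ i ∈ Finset.range j,
      (chordSq N ((N - i / 2 : ℕ) : ℝ) - chordSq N ((2 * N + 1) * θ / (2 * Real.pi))) := by
  have hM : (0 : ℝ) < 2 * N + 1 := by positivity
  set K : ℝ := ((2 * N + 1) / Real.pi) ^ 2 / 4 with hK
  have hK0 : 0 ≤ K := by positivity
  have hfac : ∀ (θ : ℝ) (i : ℕ), i ≤ N → chordSq N ((N - i : ℕ) : ℝ) -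
      chordSq N ((2 * N + 1) * θ / (2 * Real.pi)) =
      K * (2 * (Real.cos θ + Real.cos ((2 * i + 1) * (Real.pi / (2 * N + 1))))) := by
    intro θ i hi
    rw [chordSq_eq_cos, chordSq_eq_cos, Nat.cast_sub hi,
      show 2 * Real.pi * ((2 * N + 1) * θ / (2 * Real.pi)) / (2 * N + 1) = θ by
        field_simp [Real.pi_ne_zero],
      show 2 * Real.pi * ((N : ℝ) - i) / (2 * N + 1) =
        Real.pi - (2 * i + 1) * (Real.pi / (2 * N + 1)) by field_simp; ring, Real.cos_pi_sub, hK]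
    ring
  have hP : ∀ m : ℕ, m ≤ N → IsCosSum m fun θ => ∏ i ∈ Finset.range m,
      (chordSq N ((N - i : ℕ) : ℝ) - chordSq N ((2 * N + 1) * θ / (2 * Real.pi))) := by
    intro m hm
    have h := (isCosSum_prod_cos_add_cos (φ := Real.pi / (2 * N + 1)) (m := m) (by positivity) (by
      rw [← mul_div_assoc, div_lt_iff₀ hM, mul_comm]
      have : (m : ℝ) ≤ N := by exact_mod_cast hm
      exact mul_lt_mul_of_pos_left (by linarith) Real.pi_pos)).const_mul (pow_nonneg hK0 m)
    convert h using 2 with θ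
    rw [Finset.prod_congr rfl fun i hi => hfac θ i ((Finset.mem_range.1 hi).le.trans hm),
      Finset.prod_mul_distrib, Finset.prod_const, Finset.card_range]
  rcases Nat.even_or_odd' j with ⟨m, rfl | rfl⟩
  · have := (hP m (by omega)).mul (hP m (by omega))
    rw [← two_mul] at this
    convert this using 2 with θ
    rw [prod_range_two_mul_div_two (fun i => chordSq N ((N - i : ℕ) : ℝ) -
      chordSq N ((2 * N + 1) * θ / (2 * Real.pi))), sq]
  · have := (hP m (by omega)).mul (hP (m + 1) (by omega))
    rw [show m + (m + 1) = 2 * m + 1 by ring] at this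
    convert this using 2 with θ
    rw [Finset.prod_range_succ, prod_range_two_mul_div_two (fun i => chordSq N ((N - i : ℕ) : ℝ) -
      chordSq N ((2 * N + 1) * θ / (2 * Real.pi))), show 2 * m / 2 = m by omega,
      Finset.prod_range_succ]
    ring

/-- The value at `0` of the cosine polynomial of degree less than `2 N` that agrees with
`F 0 ∘ chordSq N` to second order at the nonzero integers modulo `2 N + 1`. -/
def circleOrigin (F : ℕ → ℝ → ℝ) (N : ℕ) : ℝ :=
  -2 * ∑ k ∈ Finset.range N,
      F 0 (chordSq N (k + 1)) * Real.cos (2 * Real.pi * (k + 1) / (2 * N + 1))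
    - (2 * N + 1) / Real.pi * ∑ k ∈ Finset.range N,
      F 1 (chordSq N (k + 1)) * chordSqDeriv N (k + 1) *
        Real.sin (2 * Real.pi * (k + 1) / (2 * N + 1))

/-- A function of `t` whose value at `j / (2 N + 1)` is, up to normalization, the `j`-th
coefficient of the cosine polynomial of degree less than `2 N` that agrees with
`F 0 ∘ chordSq N` to second order at the nonzero integers modulo `2 N + 1`. -/
def circleDual (F : ℕ → ℝ → ℝ) (N : ℕ) (t : ℝ) : ℝ :=
  (1 - t) * (circleOrigin F N + 2 * ∑ k ∈ Finset.range N,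
      F 0 (chordSq N (k + 1)) * Real.cos (2 * Real.pi * (k + 1) * t))
    - 1 / Real.pi * ∑ k ∈ Finset.range N,
      F 1 (chordSq N (k + 1)) * chordSqDeriv N (k + 1) * Real.sin (2 * Real.pi * (k + 1) * t)

namespace IsCMTower

variable {F : ℕ → ℝ → ℝ}

/-- The Hermite interpolant of `F 0 ∘ chordSq N` at the nonzero integers modulo `2 N + 1` is a
cosine polynomial of degree less than `2 N` with nonnegative coefficients, and it lies below
`F 0 ∘ chordSq N`. -/
theorem exists_circle_interpolant (hF : IsCMTower F) {N : ℕ} (hN : 1 ≤ N) :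
    ∃ b : ℕ → ℝ, (∀ l, 0 ≤ b l) ∧ b (2 * N) = 0 ∧ ∃ h : ℝ → ℝ,
      (∀ x, h x = ∑ l ∈ Finset.range (2 * N + 1),
        b l * Real.cos (2 * Real.pi * (l * x) / (2 * N + 1))) ∧
      (∀ x, 0 < chordSq N x → h x ≤ F 0 (chordSq N x)) ∧
      ∀ k : ℕ, 1 ≤ k → k ≤ 2 * N → h k = F 0 (chordSq N k) ∧
        HasDerivAt h (F 1 (chordSq N k) * chordSqDeriv N k) k := by
  -- each node twice, the farthest first
  set a : ℕ → ℝ := fun i => chordSq N ((N - i / 2 : ℕ) : ℝ) with ha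
  have ha0 : ∀ i < 2 * N, 0 < a i := by
    intro i hi
    refine chordSq_pos ?_ ?_
    · exact_mod_cast (by omega : 0 < N - i / 2)
    · exact_mod_cast (by omega : N - i / 2 < 2 * N + 1)
  obtain ⟨c, G, hc, hG, hcG⟩ := hF.exists_newton a (2 * N) ha0
  set H : ℝ → ℝ := fun y => ∑ j ∈ Finset.range (2 * N), c j * ∏ i ∈ Finset.range j, (a i - y)
    with hH
  set P : ℝ → ℝ := fun y => ∏ i ∈ Finset.range N, (chordSq N ((N - i : ℕ) : ℝ) - y) with hP
  have hHP : ∀ y, 0 < y → F 0 y = H y + P y ^ 2 * G 0 y := by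
    intro y hy
    rw [hcG y hy, hP, ha]
    simp only
    rw [← prod_range_two_mul_div_two (fun i => chordSq N ((N - i : ℕ) : ℝ) - y)]
  have hcos : IsCosSum (2 * N - 1) fun θ => H (chordSq N ((2 * N + 1) * θ / (2 * Real.pi))) :=
    IsCosSum.sum fun j hj => ((isCosSum_partialProd (Finset.mem_range.1 hj)).mono (by
      have := Finset.mem_range.1 hj
      omega)).const_mul (hc j)
  obtain ⟨b, hb, hb'⟩ := hcos
  -- the degree is at most `2 N - 1`, so the coefficient of degree `2 N` may be taken to vanish
  refine ⟨fun l => if l < 2 * N then b l else 0, fun l => ?_, by simp, fun x => H (chordSq N x),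
    fun x => ?_, fun x hx => ?_, fun k hk1 hk2 => ?_⟩
  · dsimp only
    split_ifs
    exacts [hb l, le_rfl]
  · have := hb' (2 * Real.pi * x / (2 * N + 1))
    beta_reduce at this
    rw [show (2 * N + 1) * (2 * Real.pi * x / (2 * N + 1)) / (2 * Real.pi) = x by
      field_simp [Real.pi_ne_zero], show 2 * N - 1 + 1 = 2 * N by omega] at this
    rw [Finset.sum_range_succ]
    simp only [lt_self_iff_false, if_false, zero_mul, add_zero]
    refine this.trans (Finset.sum_congr rfl fun l hl => ?_)
    rw [if_pos (Finset.mem_range.1 hl)]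
    congr 2
    ring
  · rw [hHP _ hx]
    have := mul_nonneg (sq_nonneg (P (chordSq N x))) (hG.nonneg hx)
    linarith
  · have hpos : 0 < chordSq N k :=
      chordSq_pos (by exact_mod_cast hk1) (by exact_mod_cast Nat.lt_succ_of_le hk2)
    have hzero : P (chordSq N k) = 0 := by
      rw [hP]
      rcases le_or_gt k N with h | h
      · refine Finset.prod_eq_zero (i := N - k) (Finset.mem_range.2 (by omega)) ?_
        rw [Nat.sub_sub_self h, sub_self]
      · refine Finset.prod_eq_zero (i := k - N - 1) (Finset.mem_range.2 (by omega)) ?_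
        rw [show N - (k - N - 1) = 2 * N + 1 - k by omega, Nat.cast_sub (by omega)]
        push_cast
        rw [chordSq_reflect, sub_self]
    refine ⟨by rw [hHP _ hpos, hzero]; simp, ?_⟩
    have hdiff : DifferentiableAt ℝ P (chordSq N k) := by
      rw [hP]
      fun_prop
    have hder : HasDerivAt H (F 1 (chordSq N k)) (chordSq N k) := by
      have h1 := (hF.hasDerivAt 0 _ hpos).sub
        ((hdiff.hasDerivAt.pow 2).mul (hG.hasDerivAt 0 _ hpos))
      have h2 : HasDerivAt (fun y => F 0 y - P y ^ 2 * G 0 y) (F 1 (chordSq N k))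
          (chordSq N k) := by
        refine h1.congr_deriv ?_
        simp [hzero]
      refine h2.congr_of_eventuallyEq ?_
      filter_upwards [Ioi_mem_nhds hpos] with y hy
      rw [hHP y hy]
      ring
    exact hder.comp (k : ℝ) (hasDerivAt_chordSq N k)

/-- The values of `circleDual` are the coefficients of the interpolant on the circle; they are
nonnegative, and the cosine polynomial that they form lies below `F 0 ∘ chordSq N`. -/
theorem circleDual_nonneg_and_sum_le (hF : IsCMTower F) {N : ℕ} (hN : 1 ≤ N) :
    (∀ j < 2 * N + 1, 0 ≤ circleDual F N ((j : ℝ) / (2 * N + 1))) ∧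
    ∀ x, 0 < chordSq N x →
      2 / (2 * N + 1) * ∑ l ∈ Finset.range (2 * N + 1), circleDual F N ((l : ℝ) / (2 * N + 1)) *
        Real.cos (2 * Real.pi * x * ((l : ℝ) / (2 * N + 1))) - circleDual F N 0 / (2 * N + 1) ≤
      F 0 (chordSq N x) := by
  have hM : (0 : ℝ) < 2 * N + 1 := by positivity
  have hMc : ((2 * N + 1 : ℕ) : ℝ) = 2 * N + 1 := by push_cast; ring
  obtain ⟨b, hb, hb0, h, hh, hle, hint⟩ := hF.exists_circle_interpolant hN
  set v : ℝ → ℝ := fun x => ∑ l ∈ Finset.range (2 * N + 1),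
      b l * (-(2 * Real.pi * l / (2 * N + 1)) * Real.sin (2 * Real.pi * (l * x) / (2 * N + 1)))
    with hv
  have hder : ∀ x, HasDerivAt h (v x) x := by
    intro x
    rw [funext hh, hv]
    refine HasDerivAt.fun_sum fun l _ => ?_
    have h1 : HasDerivAt (fun x : ℝ => 2 * Real.pi * (l * x) / (2 * N + 1))
        (2 * Real.pi * l / (2 * N + 1)) x := by
      simpa using ((((hasDerivAt_id x).const_mul (l : ℝ)).const_mul (2 * Real.pi)).div_const
        (2 * (N : ℝ) + 1))
    refine (h1.cos.const_mul (b l)).congr_deriv ?_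
    ring
  have hcoef : ∀ j < 2 * N + 1, circleCoeff (2 * N + 1) j (fun k => h k) (fun k => v k) =
      b j * if j = 0 then (2 * N + 1 : ℝ) else (2 * N + 1) / 2 := by
    intro j hj
    rw [circleCoeff_sum hj b _ _ (fun k => by rw [hh, hMc]) (fun k => by rw [hv, hMc]), hMc]
  have hfold : ∀ j : ℕ, circleCoeff (2 * N + 1) j (fun k => h k) (fun k => v k) =
      (1 - (j : ℝ) / (2 * N + 1)) * (h 0 + 2 * ∑ k ∈ Finset.range N,
        F 0 (chordSq N (k + 1)) * Real.cos (2 * Real.pi * (k + 1) * (j / (2 * N + 1))))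
      - 1 / Real.pi * ∑ k ∈ Finset.range N,
        F 1 (chordSq N (k + 1)) * chordSqDeriv N (k + 1) *
          Real.sin (2 * Real.pi * (k + 1) * (j / (2 * N + 1))) := by
    intro j
    have hu : ∀ k : ℕ, 1 ≤ k → k ≤ 2 * N → h k = F 0 (chordSq N k) :=
      fun k h1 h2 => (hint k h1 h2).1
    have hv' : ∀ k : ℕ, 1 ≤ k → k ≤ 2 * N → v k = F 1 (chordSq N k) * chordSqDeriv N k :=
      fun k h1 h2 => (hder k).unique (hint k h1 h2).2
    have hang : ∀ k : ℕ, k ≤ N → 2 * Real.pi * (j * (2 * N + 1 - k)) / (2 * N + 1) =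
        j * (2 * Real.pi) - 2 * Real.pi * (j * k) / (2 * N + 1) := fun k _ => by field_simp
    rw [circleCoeff, sum_range_fold, sum_range_fold]
    · have e1 : ∑ k ∈ Finset.range N, h ((k + 1 : ℕ) : ℝ) *
          Real.cos (2 * Real.pi * (j * ((k + 1 : ℕ) : ℝ)) / ((2 * N + 1 : ℕ) : ℝ)) =
          ∑ k ∈ Finset.range N, F 0 (chordSq N (k + 1)) *
            Real.cos (2 * Real.pi * (k + 1) * (j / (2 * N + 1))) := by
        refine Finset.sum_congr rfl fun k hk => ?_
        have := Finset.mem_range.1 hk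
        rw [hu (k + 1) (by omega) (by omega)]
        push_cast
        ring_nf
      have e2 : ∑ k ∈ Finset.range N, v ((k + 1 : ℕ) : ℝ) *
          Real.sin (2 * Real.pi * (j * ((k + 1 : ℕ) : ℝ)) / ((2 * N + 1 : ℕ) : ℝ)) =
          ∑ k ∈ Finset.range N, F 1 (chordSq N (k + 1)) * chordSqDeriv N (k + 1) *
            Real.sin (2 * Real.pi * (k + 1) * (j / (2 * N + 1))) := by
        refine Finset.sum_congr rfl fun k hk => ?_
        have := Finset.mem_range.1 hk
        rw [hv' (k + 1) (by omega) (by omega)]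
        push_cast
        ring_nf
      rw [e1, e2]
      simp only [Nat.cast_zero, mul_zero, zero_div, Real.cos_zero, Real.sin_zero, mul_one, zero_add]
      rw [hMc]
      ring
    · intro k hk1 hk2
      rw [hv' k hk1 (by omega), hv' (2 * N + 1 - k) (by omega) (by omega), Nat.cast_sub (by omega),
        hMc, chordSq_reflect, chordSqDeriv_reflect, hang k hk2, Real.sin_nat_mul_two_pi_sub]
      ring
    · intro k hk1 hk2
      rw [hu k hk1 (by omega), hu (2 * N + 1 - k) (by omega) (by omega), Nat.cast_sub (by omega),
        hMc, chordSq_reflect, hang k hk2, Real.cos_nat_mul_two_pi_sub]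
  -- the vanishing coefficient of degree `2 N` determines the value at the origin
  have horigin : h 0 = circleOrigin F N := by
    have h1 := hcoef (2 * N) (by omega)
    rw [hb0, zero_mul, hfold] at h1
    have e1 : ∀ k : ℕ, 2 * Real.pi * ((k : ℝ) + 1) * (((2 * N : ℕ) : ℝ) / (2 * N + 1)) =
        ((k + 1 : ℕ) : ℝ) * (2 * Real.pi) - 2 * Real.pi * (k + 1) / (2 * N + 1) := by
      intro k; push_cast; field_simp; ring
    simp only [e1, Real.cos_nat_mul_two_pi_sub, Real.sin_nat_mul_two_pi_sub] at h1
    have e2 : (1 : ℝ) - ((2 * N : ℕ) : ℝ) / (2 * N + 1) = 1 / (2 * N + 1) := by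
      push_cast; field_simp; ring
    simp only [e2, mul_neg, Finset.sum_neg_distrib] at h1
    rw [circleOrigin]
    generalize ∑ k ∈ Finset.range N, F 0 (chordSq N (k + 1)) *
      Real.cos (2 * Real.pi * (k + 1) / (2 * N + 1)) = S at h1 ⊢
    generalize ∑ k ∈ Finset.range N, F 1 (chordSq N (k + 1)) * chordSqDeriv N (k + 1) *
        Real.sin (2 * Real.pi * (k + 1) / (2 * N + 1)) = T at h1 ⊢
    field_simp at h1 ⊢
    linarith
  have hdual : ∀ j < 2 * N + 1, circleDual F N ((j : ℝ) / (2 * N + 1)) =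
      b j * if j = 0 then (2 * N + 1 : ℝ) else (2 * N + 1) / 2 := by
    intro j hj
    rw [← hcoef j hj, hfold, horigin, circleDual]
  refine ⟨fun j hj => ?_, fun x hx => ?_⟩
  · rw [hdual j hj]
    refine mul_nonneg (hb j) ?_
    split_ifs <;> positivity
  · refine le_trans (le_of_eq ?_) (hle x hx)
    have h0 : circleDual F N 0 = b 0 * (2 * N + 1) := by
      have := hdual 0 (by omega)
      simpa using this
    rw [hh, Finset.sum_range_succ', Finset.sum_range_succ', h0]
    have e1 : ∀ l ∈ Finset.range (2 * N), circleDual F N (((l + 1 : ℕ) : ℝ) / (2 * N + 1)) *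
        Real.cos (2 * Real.pi * x * (((l + 1 : ℕ) : ℝ) / (2 * N + 1))) =
        (2 * N + 1) / 2 * (b (l + 1) *
          Real.cos (2 * Real.pi * (((l + 1 : ℕ) : ℝ) * x) / (2 * N + 1))) := by
      intro l hl
      have := Finset.mem_range.1 hl
      rw [hdual (l + 1) (by omega), if_neg (Nat.succ_ne_zero l)]
      rw [show 2 * Real.pi * x * (((l + 1 : ℕ) : ℝ) / (2 * N + 1)) =
        2 * Real.pi * (((l + 1 : ℕ) : ℝ) * x) / (2 * N + 1) by ring]
      ring
    rw [Finset.sum_congr rfl e1, ← Finset.mul_sum]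
    simp only [Nat.cast_zero, zero_div, h0, mul_zero, Real.cos_zero, zero_mul]
    generalize ∑ l ∈ Finset.range (2 * N), b (l + 1) *
      Real.cos (2 * Real.pi * (((l + 1 : ℕ) : ℝ) * x) / (2 * N + 1)) = S
    field_simp
    ring

end IsCMTower

/-! ### Passage from the circle to the line -/

theorem tendsto_sum_range_of_dominated {g : ℕ → ℕ → ℝ} {g' u : ℕ → ℝ} (hu : Summable u)
    (hb : ∀ N k, k < N → |g N k| ≤ u k)
    (hg : ∀ k, Tendsto (fun N => g N k) atTop (nhds (g' k))) :
    Tendsto (fun N => ∑ k ∈ Finset.range N, g N k) atTop (nhds (∑' k, g' k)) := by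
  have hu0 : ∀ k, 0 ≤ u k := fun k => (abs_nonneg _).trans (hb (k + 1) k k.lt_succ_self)
  have h := tendsto_tsum_of_dominated_convergence (𝓕 := atTop)
    (f := fun N k => if k < N then g N k else 0) (g := g') (bound := u) hu
    (fun k => ((hg k).congr' (by
      filter_upwards [eventually_gt_atTop k] with N hN
      rw [if_pos hN])))
    (Eventually.of_forall fun N k => by
      split_ifs with h
      exacts [hb N k h, by simpa using hu0 k])
  refine h.congr fun N => ?_
  rw [tsum_eq_sum (s := Finset.range N) fun k hk => if_neg fun h => hk (Finset.mem_range.2 h)]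
  exact Finset.sum_congr rfl fun k hk => if_pos (Finset.mem_range.1 hk)

/-- A sum over `range M` as the integral of a step function on `[0, M]`. -/
theorem integral_comp_natFloor (φ : ℕ → ℝ) (M : ℕ) :
    ∫ s in (0 : ℝ)..M, φ ⌊s⌋₊ = ∑ l ∈ Finset.range M, φ l := by
  have hmeas : Measurable fun s : ℝ => φ ⌊s⌋₊ := measurable_from_nat.comp Nat.measurable_floor
  have hcongr : ∀ l : ℕ, EqOn (fun _ => φ l) (fun s : ℝ => φ ⌊s⌋₊)
      (Ioo (l : ℝ) ((l + 1 : ℕ) : ℝ)) := by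
    intro l s hs
    have : ⌊s⌋₊ = l := (Nat.floor_eq_iff ((Nat.cast_nonneg l).trans hs.1.le)).2
      ⟨hs.1.le, by simpa using hs.2⟩
    simp only [this]
  have hle : ∀ l : ℕ, (l : ℝ) ≤ ((l + 1 : ℕ) : ℝ) := fun l => by push_cast; linarith
  have hint : ∀ l : ℕ, ∫ s in (l : ℝ)..((l + 1 : ℕ) : ℝ), φ ⌊s⌋₊ = φ l := by
    intro l
    rw [intervalIntegral.integral_of_le (hle l), integral_Ioc_eq_integral_Ioo,
      ← setIntegral_congr_fun measurableSet_Ioo (hcongr l)]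
    simp
  have hii : ∀ l : ℕ, IntervalIntegrable (fun s : ℝ => φ ⌊s⌋₊) volume (l : ℝ)
      ((l + 1 : ℕ) : ℝ) := by
    intro l
    rw [intervalIntegrable_iff_integrableOn_Ioo_of_le (hle l)]
    exact IntegrableOn.congr_fun (integrableOn_const (by simp)) (hcongr l) measurableSet_Ioo
  have := intervalIntegral.sum_integral_adjacent_intervals (a := fun l : ℕ => (l : ℝ)) (n := M)
    (f := fun s : ℝ => φ ⌊s⌋₊) (μ := volume) fun l _ => hii l
  rw [← Nat.cast_zero, ← this]
  exact Finset.sum_congr rfl fun l _ => hint l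

/-- Convergence of the Riemann sums of a sequence of functions that converges continuously. -/
theorem tendsto_riemannSum {g : ℕ → ℝ → ℝ} {g' : ℝ → ℝ} {C : ℝ} {M : ℕ → ℕ}
    (hM0 : ∀ N, 0 < M N) (hM : Tendsto M atTop atTop)
    (hC : ∀ N, ∀ t ∈ Icc (0 : ℝ) 1, |g N t| ≤ C)
    (hg : ∀ (s : ℕ → ℝ) (t : ℝ), Tendsto s atTop (nhds t) →
      Tendsto (fun N => g N (s N)) atTop (nhds (g' t))) :
    Tendsto (fun N => 1 / (M N : ℝ) * ∑ l ∈ Finset.range (M N), g N ((l : ℝ) / M N)) atTop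
      (nhds (∫ t in (0 : ℝ)..1, g' t)) := by
  have hM' : Tendsto (fun N => (M N : ℝ)) atTop atTop := tendsto_natCast_atTop_atTop.comp hM
  have hpos : ∀ N, (0 : ℝ) < M N := fun N => by exact_mod_cast hM0 N
  have h1 : ∀ N, 1 / (M N : ℝ) * ∑ l ∈ Finset.range (M N), g N ((l : ℝ) / M N) =
      ∫ t in (0 : ℝ)..1, g N ((⌊(M N : ℝ) * t⌋₊ : ℝ) / M N) := by
    intro N
    rw [← integral_comp_natFloor (fun l => g N ((l : ℝ) / M N)) (M N)]
    have := intervalIntegral.integral_comp_mul_left (a := 0) (b := 1)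
      (fun s : ℝ => g N ((⌊s⌋₊ : ℝ) / M N)) (hpos N).ne'
    rw [this, mul_zero, mul_one, smul_eq_mul, one_div]
  simp only [h1]
  refine intervalIntegral.tendsto_integral_filter_of_dominated_convergence (fun _ => C)
    (Eventually.of_forall fun N => ?_) (Eventually.of_forall fun N => ?_)
    intervalIntegrable_const (Eventually.of_forall fun t ht => ?_)
  · have : Measurable fun t : ℝ => g N ((⌊(M N : ℝ) * t⌋₊ : ℝ) / M N) :=
      (measurable_from_nat (f := fun l : ℕ => g N ((l : ℝ) / M N))).comp
        (Nat.measurable_floor.comp (measurable_const_mul _))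
    exact this.aestronglyMeasurable
  · refine Eventually.of_forall fun t ht => ?_
    rw [uIoc_of_le zero_le_one] at ht
    refine hC N _ ⟨by have := hpos N; positivity, ?_⟩
    rw [div_le_one (hpos N)]
    refine (Nat.floor_le (mul_nonneg (hpos N).le ht.1.le)).trans ?_
    nlinarith [hpos N, ht.2]
  · rw [uIoc_of_le zero_le_one] at ht
    refine hg _ t ?_
    have h2 := (tendsto_nat_floor_mul_div_atTop ht.1.le).comp hM'
    simpa only [Function.comp_def, mul_comm t] using h2

theorem Real.sin_eq_mul_sinc (y : ℝ) : Real.sin y = y * Real.sinc y := by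
  rcases eq_or_ne y 0 with rfl | hy
  · simp
  · rw [Real.sinc_of_ne_zero hy]; field_simp

theorem tendsto_two_mul_add_one : Tendsto (fun N : ℕ => (2 * N + 1 : ℝ)) atTop atTop :=
  tendsto_atTop_add_const_right _ _
    (tendsto_natCast_atTop_atTop.const_mul_atTop (by norm_num : (0 : ℝ) < 2))

theorem tendsto_sinc_div (c : ℝ) :
    Tendsto (fun N : ℕ => Real.sinc (c / (2 * N + 1))) atTop (nhds 1) := by
  have h : Tendsto (fun N : ℕ => c / (2 * N + 1 : ℝ)) atTop (nhds 0) :=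
    tendsto_two_mul_add_one.const_div_atTop c
  have := (Real.continuous_sinc.tendsto 0).comp h
  rwa [Real.sinc_zero] at this

theorem tendsto_chordSq (x : ℝ) : Tendsto (fun N => chordSq N x) atTop (nhds (x ^ 2)) := by
  have h := ((tendsto_sinc_div (Real.pi * x)).pow 2).const_mul (x ^ 2)
  rw [one_pow, mul_one] at h
  refine h.congr fun N => ?_
  have hM : (0 : ℝ) < 2 * N + 1 := by positivity
  rw [chordSq, Real.sin_eq_mul_sinc]
  field_simp

theorem tendsto_scaled_sin (x : ℝ) : Tendsto
    (fun N : ℕ => (2 * N + 1) / Real.pi * Real.sin (2 * Real.pi * x / (2 * N + 1))) atTop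
      (nhds (2 * x)) := by
  have h := (tendsto_sinc_div (2 * Real.pi * x)).const_mul (2 * x)
  rw [mul_one] at h
  refine h.congr fun N => ?_
  have hM : (0 : ℝ) < 2 * N + 1 := by positivity
  rw [Real.sin_eq_mul_sinc]
  field_simp

theorem tendsto_chordSqDeriv (x : ℝ) :
    Tendsto (fun N => chordSqDeriv N x) atTop (nhds (2 * x)) := tendsto_scaled_sin x

theorem abs_scaled_sin_le (N : ℕ) {x : ℝ} (hx : 0 ≤ x) :
    |(2 * N + 1) / Real.pi * Real.sin (2 * Real.pi * x / (2 * N + 1))| ≤ 2 * x := by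
  have hM : (0 : ℝ) < 2 * N + 1 := by positivity
  rw [abs_mul, abs_of_nonneg (by positivity : (0 : ℝ) ≤ (2 * N + 1) / Real.pi)]
  have h1 : |Real.sin (2 * Real.pi * x / (2 * N + 1))| ≤ 2 * Real.pi * x / (2 * N + 1) :=
    Real.abs_sin_le_abs.trans (abs_of_nonneg (by positivity)).le
  calc _ ≤ (2 * N + 1) / Real.pi * (2 * Real.pi * x / (2 * N + 1)) :=
        mul_le_mul_of_nonneg_left h1 (by positivity)
    _ = 2 * x := by field_simp

theorem le_chordSq {N : ℕ} {x : ℝ} (h0 : 0 ≤ x) (h1 : x ≤ N) :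
    4 * x ^ 2 / Real.pi ^ 2 ≤ chordSq N x := by
  have hM : (0 : ℝ) < 2 * N + 1 := by positivity
  have h2 := Real.mul_le_sin (x := Real.pi * x / (2 * N + 1)) (by positivity) (by
    rw [div_le_div_iff₀ hM (by norm_num)]
    nlinarith [Real.pi_pos])
  have h3 : 2 / Real.pi * (Real.pi * x / (2 * N + 1)) = 2 * x / (2 * N + 1) := by field_simp
  rw [h3] at h2
  calc 4 * x ^ 2 / Real.pi ^ 2 = ((2 * N + 1) / Real.pi) ^ 2 * (2 * x / (2 * N + 1)) ^ 2 := by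
        field_simp; ring
    _ ≤ chordSq N x := by unfold chordSq; gcongr

theorem one_le_sq_pi : (1 : ℝ) ≤ Real.pi ^ 2 := by nlinarith [Real.pi_gt_three]

theorem four_mul_sq_div_sq_pi_le (k : ℕ) :
    4 * ((k : ℝ) + 1) ^ 2 / Real.pi ^ 2 ≤ ((k : ℝ) + 1) ^ 2 := by
  rw [div_le_iff₀ (by positivity)]
  nlinarith [Real.pi_gt_three, sq_nonneg ((k : ℝ) + 1), mul_nonneg (sq_nonneg ((k : ℝ) + 1))
    (by nlinarith [Real.pi_gt_three] : (0 : ℝ) ≤ Real.pi ^ 2 - 4)]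

theorem abs_mul_cos_le (a θ : ℝ) : |a * Real.cos θ| ≤ |a| := by
  rw [abs_mul]
  exact mul_le_of_le_one_right (abs_nonneg _) (Real.abs_cos_le_one _)

theorem abs_mul_sin_le (a θ : ℝ) : |a * Real.sin θ| ≤ |a| := by
  rw [abs_mul]
  exact mul_le_of_le_one_right (abs_nonneg _) (Real.abs_sin_le_one _)

theorem cast_succ_le_of_lt {N k : ℕ} (h : k < N) : (k : ℝ) + 1 ≤ N := by exact_mod_cast h

theorem abs_sum_range_le {u g : ℕ → ℝ} (hu : Summable u) (hu0 : ∀ k, 0 ≤ u k) {N : ℕ}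
    (h : ∀ k < N, |g k| ≤ u k) : |∑ k ∈ Finset.range N, g k| ≤ ∑' k, u k :=
  (Finset.abs_sum_le_sum_abs _ _).trans ((Finset.sum_le_sum fun k hk =>
    h k (Finset.mem_range.1 hk)).trans (hu.sum_le_tsum _ fun k _ => hu0 k))

namespace IsCMTower

variable {F : ℕ → ℝ → ℝ}

/-- A common bound for the values and the scaled derivatives of `F 0`, both at the points
`(k + 1) ^ 2` and at the points `chordSq N (k + 1)`. The factor `2 / π ^ 2` combines
`4 (k + 1) ^ 2 / π ^ 2 ≤ chordSq N (k + 1)` with the halving in `neg_deriv_mul_le`. -/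
def majorant (F : ℕ → ℝ → ℝ) (k : ℕ) : ℝ :=
  Real.pi ^ 2 * F 0 (2 * (k + 1) ^ 2 / Real.pi ^ 2)

theorem majorant_nonneg (hF : IsCMTower F) (k : ℕ) : 0 ≤ majorant F k :=
  mul_nonneg (by positivity) (hF.nonneg (by positivity))

theorem summable_majorant {ε : ℝ} (hε : 0 < ε)
    (h : F 0 =O[atTop] fun x : ℝ => x ^ (-(1 / 2) - ε : ℝ)) : Summable (majorant F) := by
  have ht : Tendsto (fun k : ℕ => 2 * ((k : ℝ) + 1) ^ 2 / Real.pi ^ 2) atTop atTop := by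
    refine Tendsto.atTop_div_const (by positivity) (Tendsto.const_mul_atTop (by norm_num) ?_)
    exact (tendsto_pow_atTop two_ne_zero).comp
      (tendsto_atTop_add_const_right _ _ tendsto_natCast_atTop_atTop)
  have h1 := (h.comp_tendsto ht).const_mul_left (Real.pi ^ 2)
  refine summable_of_isBigO_nat ?_ h1
  have h2 : ∀ k : ℕ, ((fun x : ℝ => x ^ (-(1 / 2) - ε : ℝ)) ∘
      fun k : ℕ => 2 * ((k : ℝ) + 1) ^ 2 / Real.pi ^ 2) k =
      (2 / Real.pi ^ 2) ^ (-(1 / 2) - ε : ℝ) * ((k + 1 : ℕ) : ℝ) ^ (-1 - 2 * ε : ℝ) := by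
    intro k
    have hk : (0 : ℝ) < (k : ℝ) + 1 := by positivity
    simp only [Function.comp_apply]
    rw [show 2 * ((k : ℝ) + 1) ^ 2 / Real.pi ^ 2 = 2 / Real.pi ^ 2 * ((k : ℝ) + 1) ^ 2 by ring,
      Real.mul_rpow (by positivity) (by positivity), ← Real.rpow_natCast ((k : ℝ) + 1) 2,
      ← Real.rpow_mul hk.le]
    push_cast
    ring_nf
  rw [funext h2]
  refine Summable.mul_left _ ?_
  exact (summable_nat_add_iff 1).2 (Real.summable_nat_rpow.2 (by linarith))

theorem value_le_majorant (hF : IsCMTower F) (k : ℕ) {y : ℝ}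
    (hy : 4 * ((k : ℝ) + 1) ^ 2 / Real.pi ^ 2 ≤ y) : |F 0 y| ≤ majorant F k := by
  have h0 : (0 : ℝ) < 2 * ((k : ℝ) + 1) ^ 2 / Real.pi ^ 2 := by positivity
  have h1 : 2 * ((k : ℝ) + 1) ^ 2 / Real.pi ^ 2 ≤ y := le_trans (by gcongr; norm_num) hy
  have hy0 : 0 < y := h0.trans_le h1
  rw [abs_of_nonneg (hF.nonneg hy0)]
  have h2 := hF.antitoneOn h0 hy0 h1
  have h3 := hF.nonneg h0
  unfold majorant
  nlinarith [one_le_sq_pi]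

theorem deriv_le_majorant (hF : IsCMTower F) (k : ℕ) {y : ℝ}
    (hy : 4 * ((k : ℝ) + 1) ^ 2 / Real.pi ^ 2 ≤ y) :
    |F 1 y| * (2 * ((k : ℝ) + 1) ^ 2) ≤ majorant F k := by
  have h0 : (0 : ℝ) < 4 * ((k : ℝ) + 1) ^ 2 / Real.pi ^ 2 := by positivity
  have hy0 : 0 < y := h0.trans_le hy
  rw [abs_of_nonpos (hF.deriv_nonpos hy0)]
  have h1 := hF.monotoneOn_one h0 hy0 hy
  have h2 := hF.neg_deriv_mul_le h0
  rw [show 4 * ((k : ℝ) + 1) ^ 2 / Real.pi ^ 2 / 2 = 2 * ((k : ℝ) + 1) ^ 2 / Real.pi ^ 2 by ring]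
    at h2
  have h3 : -F 1 y * (2 * ((k : ℝ) + 1) ^ 2 / Real.pi ^ 2) ≤
      F 0 (2 * ((k : ℝ) + 1) ^ 2 / Real.pi ^ 2) :=
    le_trans (mul_le_mul_of_nonneg_right (neg_le_neg h1) (by positivity)) h2
  have h4 := mul_le_mul_of_nonneg_left h3 (by positivity : (0 : ℝ) ≤ Real.pi ^ 2)
  refine le_trans (le_of_eq ?_) h4
  field_simp

/-- The value at `0` of the interpolant on the line. -/
def lineOrigin (F : ℕ → ℝ → ℝ) : ℝ :=
  -2 * ∑' k : ℕ, (F 0 ((k + 1) ^ 2) + F 1 ((k + 1) ^ 2) * (2 * (k + 1)) * (k + 1))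

/-- On `[0, 1]`, the Fourier transform of the interpolant on the line. -/
def lineDual (F : ℕ → ℝ → ℝ) (t : ℝ) : ℝ :=
  (1 - t) * (lineOrigin F + 2 * ∑' k : ℕ, F 0 ((k + 1) ^ 2) * Real.cos (2 * Real.pi * (k + 1) * t))
    - 1 / Real.pi * ∑' k : ℕ,
      F 1 ((k + 1) ^ 2) * (2 * (k + 1)) * Real.sin (2 * Real.pi * (k + 1) * t)

theorem value_chordSq_le (hF : IsCMTower F) {N k : ℕ} (h : k < N) :
    |F 0 (chordSq N (k + 1))| ≤ majorant F k :=
  hF.value_le_majorant k (le_chordSq (by positivity) (cast_succ_le_of_lt h))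

theorem deriv_chordSq_mul_le (hF : IsCMTower F) {N k : ℕ} (h : k < N) :
    |F 1 (chordSq N (k + 1)) * chordSqDeriv N (k + 1)| * (k + 1) ≤ majorant F k := by
  refine le_trans ?_ (hF.deriv_le_majorant k (le_chordSq (by positivity) (cast_succ_le_of_lt h)))
  rw [abs_mul]
  have h1 : |chordSqDeriv N (k + 1)| ≤ 2 * (k + 1) := abs_scaled_sin_le N (by positivity)
  calc _ ≤ |F 1 (chordSq N (k + 1))| * (2 * (k + 1)) * (k + 1) := by gcongr
    _ = _ := by ring

theorem deriv_chordSq_le (hF : IsCMTower F) {N k : ℕ} (h : k < N) :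
    |F 1 (chordSq N (k + 1)) * chordSqDeriv N (k + 1)| ≤ majorant F k := by
  refine le_trans ?_ (hF.deriv_chordSq_mul_le h)
  exact le_mul_of_one_le_right (abs_nonneg _) (by linarith [(Nat.cast_nonneg k : (0 : ℝ) ≤ k)])

theorem deriv_chordSq_mul_sin_le (hF : IsCMTower F) {N k : ℕ} (h : k < N) :
    |F 1 (chordSq N (k + 1)) * chordSqDeriv N (k + 1) *
      ((2 * N + 1) / Real.pi * Real.sin (2 * Real.pi * (k + 1) / (2 * N + 1)))| ≤
      2 * majorant F k := by
  rw [abs_mul]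
  have h1 := abs_scaled_sin_le N (x := (k : ℝ) + 1) (by positivity)
  have h2 := hF.deriv_chordSq_mul_le h
  calc _ ≤ |F 1 (chordSq N (k + 1)) * chordSqDeriv N (k + 1)| * (2 * (k + 1)) := by gcongr
    _ ≤ _ := by linarith

theorem tendsto_value_chordSq (hF : IsCMTower F) (k : ℕ) :
    Tendsto (fun N => F 0 (chordSq N (k + 1))) atTop (nhds (F 0 ((k + 1) ^ 2))) :=
  (hF.hasDerivAt 0 _ (by positivity)).continuousAt.tendsto.comp (tendsto_chordSq _)

theorem tendsto_deriv_chordSq (hF : IsCMTower F) (k : ℕ) :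
    Tendsto (fun N => F 1 (chordSq N (k + 1)) * chordSqDeriv N (k + 1)) atTop
      (nhds (F 1 ((k + 1) ^ 2) * (2 * (k + 1)))) :=
  ((hF.hasDerivAt 1 _ (by positivity)).continuousAt.tendsto.comp (tendsto_chordSq _)).mul
    (tendsto_chordSqDeriv _)

theorem summable_value (hF : IsCMTower F) (hs : Summable (majorant F)) :
    Summable fun k : ℕ => F 0 (((k : ℝ) + 1) ^ 2) :=
  hs.of_norm_bounded fun k => hF.value_le_majorant k (four_mul_sq_div_sq_pi_le k)

theorem deriv_mul_le (hF : IsCMTower F) (k : ℕ) :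
    |F 1 (((k : ℝ) + 1) ^ 2) * (2 * (k + 1)) * (k + 1)| ≤ majorant F k := by
  refine le_trans (le_of_eq ?_) (hF.deriv_le_majorant k (four_mul_sq_div_sq_pi_le k))
  rw [mul_assoc, abs_mul, abs_of_nonneg (by positivity : (0 : ℝ) ≤ 2 * ((k : ℝ) + 1) * (k + 1))]
  ring

theorem deriv_le (hF : IsCMTower F) (k : ℕ) :
    |F 1 (((k : ℝ) + 1) ^ 2) * (2 * (k + 1))| ≤ majorant F k := by
  refine le_trans ?_ (hF.deriv_mul_le k)
  rw [abs_mul _ ((k : ℝ) + 1), abs_of_nonneg (by positivity : (0 : ℝ) ≤ (k : ℝ) + 1)]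
  exact le_mul_of_one_le_right (abs_nonneg _) (by linarith [(Nat.cast_nonneg k : (0 : ℝ) ≤ k)])

theorem circleOrigin_eq (F : ℕ → ℝ → ℝ) (N : ℕ) : circleOrigin F N =
    -2 * ∑ k ∈ Finset.range N,
      F 0 (chordSq N (k + 1)) * Real.cos (2 * Real.pi * (k + 1) / (2 * N + 1))
    - ∑ k ∈ Finset.range N, F 1 (chordSq N (k + 1)) * chordSqDeriv N (k + 1) *
        ((2 * N + 1) / Real.pi * Real.sin (2 * Real.pi * (k + 1) / (2 * N + 1))) := by
  rw [circleOrigin, Finset.mul_sum (s := Finset.range N) (a := (2 * (N : ℝ) + 1) / Real.pi)]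
  congr 1
  exact Finset.sum_congr rfl fun k _ => by ring

theorem tendsto_circleOrigin (hF : IsCMTower F) (hs : Summable (majorant F)) :
    Tendsto (circleOrigin F) atTop (nhds (lineOrigin F)) := by
  have hcos : ∀ k : ℕ, Tendsto (fun N : ℕ => Real.cos (2 * Real.pi * (k + 1) / (2 * N + 1))) atTop
      (nhds 1) := by
    intro k
    have h : Tendsto (fun N : ℕ => 2 * Real.pi * ((k : ℝ) + 1) / (2 * N + 1 : ℝ)) atTop (nhds 0) :=
      tendsto_two_mul_add_one.const_div_atTop _
    have := (Real.continuous_cos.tendsto 0).comp h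
    rwa [Real.cos_zero] at this
  have h1 := tendsto_sum_range_of_dominated hs
    (fun N k h => (abs_mul_cos_le _ (2 * Real.pi * (k + 1) / (2 * N + 1))).trans
      (hF.value_chordSq_le h))
    (fun k => (hF.tendsto_value_chordSq k).mul (hcos k))
  have h2 := tendsto_sum_range_of_dominated (hs.mul_left 2)
    (fun N k h => hF.deriv_chordSq_mul_sin_le h)
    (fun k => (hF.tendsto_deriv_chordSq k).mul (tendsto_scaled_sin _))
  have h3 := (h1.const_mul (-2)).sub h2
  have e : lineOrigin F = -2 * ∑' k : ℕ, F 0 (((k : ℝ) + 1) ^ 2) * 1 -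
      ∑' k : ℕ, F 1 (((k : ℝ) + 1) ^ 2) * (2 * (k + 1)) * (2 * (k + 1)) := by
    rw [lineOrigin, Summable.tsum_add (hF.summable_value hs)
      (hs.of_norm_bounded fun k => hF.deriv_mul_le k)]
    have : ∀ k : ℕ, F 1 (((k : ℝ) + 1) ^ 2) * (2 * (k + 1)) * (2 * (k + 1)) =
      2 * (F 1 (((k : ℝ) + 1) ^ 2) * (2 * (k + 1)) * (k + 1)) := fun k => by ring
    simp only [this, tsum_mul_left, mul_one]
    ring
  rw [e]
  exact h3.congr fun N => (circleOrigin_eq F N).symm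

/-- The transforms on the circle converge to the transform on the line, even along moving
arguments. -/
theorem tendsto_circleDual (hF : IsCMTower F) (hs : Summable (majorant F)) {s : ℕ → ℝ} {t : ℝ}
    (h : Tendsto s atTop (nhds t)) :
    Tendsto (fun N => circleDual F N (s N)) atTop (nhds (lineDual F t)) := by
  have h1 := tendsto_sum_range_of_dominated hs
    (fun N k h => (abs_mul_cos_le _ (2 * Real.pi * (k + 1) * s N)).trans
      (hF.value_chordSq_le h))
    (fun k => (hF.tendsto_value_chordSq k).mul
      ((Real.continuous_cos.tendsto _).comp (h.const_mul (2 * Real.pi * (k + 1)))))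
  have h2 := tendsto_sum_range_of_dominated hs
    (fun N k h => (abs_mul_sin_le _ (2 * Real.pi * (k + 1) * s N)).trans
      (hF.deriv_chordSq_le h))
    (fun k => (hF.tendsto_deriv_chordSq k).mul
      ((Real.continuous_sin.tendsto _).comp (h.const_mul (2 * Real.pi * (k + 1)))))
  exact ((tendsto_const_nhds.sub h).mul ((hF.tendsto_circleOrigin hs).add
    (h1.const_mul 2))).sub (h2.const_mul (1 / Real.pi))

theorem abs_circleDual_le (hF : IsCMTower F) (hs : Summable (majorant F)) (N : ℕ) {t : ℝ}
    (ht : t ∈ Icc (0 : ℝ) 1) : |circleDual F N t| ≤ 7 * ∑' k, majorant F k := by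
  have h0 := hF.majorant_nonneg
  have h1 := abs_sum_range_le hs h0 (N := N) fun k h =>
    (abs_mul_cos_le _ (2 * Real.pi * (k + 1) / (2 * N + 1))).trans (hF.value_chordSq_le h)
  have h2 := abs_sum_range_le (hs.mul_left 2) (fun k => mul_nonneg zero_le_two (h0 k)) (N := N)
    fun k h => hF.deriv_chordSq_mul_sin_le h
  have h3 := abs_sum_range_le hs h0 (N := N) fun k h =>
    (abs_mul_cos_le _ (2 * Real.pi * (k + 1) * t)).trans (hF.value_chordSq_le h)
  have h4 := abs_sum_range_le hs h0 (N := N) fun k h =>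
    (abs_mul_sin_le _ (2 * Real.pi * (k + 1) * t)).trans (hF.deriv_chordSq_le h)
  rw [tsum_mul_left] at h2
  have h5 : |circleOrigin F N| ≤ 4 * ∑' k, majorant F k := by
    rw [circleOrigin_eq]
    rw [abs_le] at *
    constructor <;> linarith [h1.1, h1.2, h2.1, h2.2]
  set S := ∑ k ∈ Finset.range N, F 0 (chordSq N (k + 1)) * Real.cos (2 * Real.pi * (k + 1) * t)
  set T := ∑ k ∈ Finset.range N,
      F 1 (chordSq N (k + 1)) * chordSqDeriv N (k + 1) * Real.sin (2 * Real.pi * (k + 1) * t)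
  have h6 : |(1 - t) * (circleOrigin F N + 2 * S)| ≤ 6 * ∑' k, majorant F k := by
    rw [abs_mul]
    refine (mul_le_of_le_one_left (abs_nonneg _) ?_).trans ?_
    · rw [abs_le]; constructor <;> linarith [ht.1, ht.2]
    · rw [abs_le] at *
      constructor <;> linarith [h5.1, h5.2, h3.1, h3.2]
  have h7 : |1 / Real.pi * T| ≤ ∑' k, majorant F k := by
    rw [abs_mul]
    refine (mul_le_of_le_one_left (abs_nonneg _) ?_).trans h4
    rw [abs_of_nonneg (by positivity), div_le_one Real.pi_pos]
    linarith [Real.pi_gt_three]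
  calc _ ≤ |(1 - t) * (circleOrigin F N + 2 * S)| + |1 / Real.pi * T| := abs_sub _ _
    _ ≤ _ := by linarith

theorem lineDual_one (F : ℕ → ℝ → ℝ) : lineDual F 1 = 0 := by
  have : ∀ k : ℕ, Real.sin (2 * Real.pi * ((k : ℝ) + 1)) = 0 := by
    intro k
    have := Real.sin_nat_mul_pi (2 * (k + 1))
    rw [← this]
    push_cast
    ring_nf
  simp [lineDual, this]

/-- A limit of nonnegative coefficients on the circle, those of index `⌊t (2 N + 1)⌋`. -/
theorem lineDual_nonneg (hF : IsCMTower F) (hs : Summable (majorant F)) {t : ℝ}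
    (ht : t ∈ Icc (0 : ℝ) 1) : 0 ≤ lineDual F t := by
  rcases ht.2.lt_or_eq with h1 | rfl
  · have h2 : Tendsto (fun N : ℕ => (⌊t * (2 * N + 1)⌋₊ : ℝ) / (2 * N + 1)) atTop (nhds t) :=
      (tendsto_nat_floor_mul_div_atTop ht.1).comp tendsto_two_mul_add_one
    refine ge_of_tendsto (hF.tendsto_circleDual hs h2) ?_
    filter_upwards [eventually_ge_atTop 1] with N hN
    refine (hF.circleDual_nonneg_and_sum_le hN).1 _ ?_
    have hM : (0 : ℝ) < 2 * N + 1 := by positivity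
    rw [Nat.floor_lt (mul_nonneg ht.1 hM.le)]
    push_cast
    nlinarith
  · rw [lineDual_one]

/-- A limit of the corresponding inequalities on the circle, where the sums are Riemann sums. -/
theorem integral_lineDual_le (hF : IsCMTower F) (hs : Summable (majorant F)) {x : ℝ}
    (hx : x ≠ 0) :
    2 * ∫ t in (0 : ℝ)..1, lineDual F t * Real.cos (2 * Real.pi * x * t) ≤ F 0 (x ^ 2) := by
  have hx2 : 0 < x ^ 2 := by positivity
  have hlim : Tendsto (fun N => F 0 (chordSq N x)) atTop (nhds (F 0 (x ^ 2))) :=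
    (hF.hasDerivAt 0 _ hx2).continuousAt.tendsto.comp (tendsto_chordSq x)
  have hriem := tendsto_riemannSum
    (g := fun N t => circleDual F N t * Real.cos (2 * Real.pi * x * t))
    (g' := fun t => lineDual F t * Real.cos (2 * Real.pi * x * t)) (M := fun N => 2 * N + 1)
    (fun N => by positivity)
    (tendsto_atTop_mono (fun N => by simp only [id]; omega) tendsto_id)
    (fun N t ht => (abs_mul_cos_le _ _).trans (hF.abs_circleDual_le hs N ht))
    (fun s t hst => (hF.tendsto_circleDual hs hst).mul
      ((Real.continuous_cos.tendsto _).comp (hst.const_mul (2 * Real.pi * x))))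
  have hzero : Tendsto (fun N : ℕ => circleDual F N 0 / (2 * N + 1)) atTop (nhds 0) :=
    (hF.tendsto_circleDual hs tendsto_const_nhds).div_atTop tendsto_two_mul_add_one
  have h := (hriem.const_mul 2).sub hzero
  rw [sub_zero] at h
  refine le_of_tendsto_of_tendsto h hlim ?_
  filter_upwards [eventually_ge_atTop 1, (tendsto_chordSq x).eventually (Ioi_mem_nhds hx2)] with
    N hN hpos
  refine le_trans (le_of_eq ?_) ((hF.circleDual_nonneg_and_sum_le hN).2 x hpos)
  push_cast
  ring

end IsCMTower

/-! ### The Fourier transform of the interpolant -/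

theorem hasDerivAt_const_mul_id (c t : ℝ) : HasDerivAt (fun t : ℝ => c * t) c t := by
  simpa using (hasDerivAt_id t).const_mul c

theorem integral_sin_two_pi_mul (y : ℝ) :
    ∫ t in (0 : ℝ)..1, Real.sin (2 * Real.pi * y * t) = Real.pi * (y * fejer y) := by
  rcases eq_or_ne y 0 with rfl | hy
  · simp
  have hc : 2 * Real.pi * y ≠ 0 := by positivity
  have h := intervalIntegral.integral_eq_sub_of_hasDerivAt (a := 0) (b := 1)
    (f := fun t => -Real.cos (2 * Real.pi * y * t) / (2 * Real.pi * y))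
    (f' := fun t => Real.sin (2 * Real.pi * y * t))
    (fun t _ => (((hasDerivAt_const_mul_id (2 * Real.pi * y) t).cos.neg).div_const _).congr_deriv
      (by field_simp)) (Continuous.intervalIntegrable (by fun_prop) _ _)
  rw [h, fejer, Real.sinc_of_ne_zero (by positivity), mul_one, mul_zero, Real.cos_zero,
    show 2 * Real.pi * y = 2 * (Real.pi * y) by ring, Real.cos_two_mul']
  have := Real.sin_sq_add_cos_sq (Real.pi * y)
  field_simp
  linear_combination (-1 : ℝ) * this

theorem integral_one_sub_mul_cos (y : ℝ) :
    2 * ∫ t in (0 : ℝ)..1, (1 - t) * Real.cos (2 * Real.pi * y * t) = fejer y := by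
  rcases eq_or_ne y 0 with rfl | hy
  · have : ∫ t in (0 : ℝ)..1, (1 - t) = 1 / 2 := by
      rw [intervalIntegral.integral_sub (by simp) (by simp)]
      simp; norm_num
    simp [this, fejer]
  have hc : 2 * Real.pi * y ≠ 0 := by positivity
  have h := intervalIntegral.integral_eq_sub_of_hasDerivAt (a := 0) (b := 1)
    (f := fun t => (1 - t) * Real.sin (2 * Real.pi * y * t) / (2 * Real.pi * y) -
      Real.cos (2 * Real.pi * y * t) / (2 * Real.pi * y) ^ 2)
    (f' := fun t => (1 - t) * Real.cos (2 * Real.pi * y * t))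
    (fun t _ => (((((hasDerivAt_id t).const_sub 1).mul
      (hasDerivAt_const_mul_id (2 * Real.pi * y) t).sin).div_const _).sub
      (((hasDerivAt_const_mul_id (2 * Real.pi * y) t).cos).div_const _)).congr_deriv (by
      simp only [id]
      field_simp
      ring)) (Continuous.intervalIntegrable (by fun_prop) _ _)
  rw [h, fejer, Real.sinc_of_ne_zero (by positivity), mul_one, mul_zero, Real.cos_zero,
    show 2 * Real.pi * y = 2 * (Real.pi * y) by ring, Real.cos_two_mul']
  have := Real.sin_sq_add_cos_sq (Real.pi * y)
  simp only [sub_self, zero_mul, zero_div, Real.sin_zero, mul_zero]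
  field_simp
  linear_combination (-1 : ℝ) * this

theorem fejer_nonneg (y : ℝ) : 0 ≤ fejer y := sq_nonneg _

theorem fejer_le_one (y : ℝ) : fejer y ≤ 1 := by
  rw [fejer, sq_le_one_iff_abs_le_one]
  exact Real.abs_sinc_le_one _

theorem fejer_neg (y : ℝ) : fejer (-y) = fejer y := by
  rw [fejer, fejer, mul_neg, Real.sinc_neg]

theorem abs_mul_fejer_le_one (y : ℝ) : |y * fejer y| ≤ 1 := by
  have h : Real.pi * (y * fejer y) = Real.sin (Real.pi * y) * Real.sinc (Real.pi * y) := by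
    rw [fejer, Real.sin_eq_mul_sinc]; ring
  have h1 : |Real.pi * (y * fejer y)| ≤ 1 := by
    rw [h, abs_mul]
    exact mul_le_one₀ (Real.abs_sin_le_one _) (abs_nonneg _) (Real.abs_sinc_le_one _)
  rw [abs_mul, abs_of_pos Real.pi_pos] at h1
  nlinarith [Real.pi_gt_three, abs_nonneg (y * fejer y)]

theorem fejer_int {k : ℤ} (hk : k ≠ 0) : fejer k = 0 := by
  have : (k : ℝ) ≠ 0 := by exact_mod_cast hk
  rw [fejer, Real.sinc_of_ne_zero (by positivity), mul_comm, Real.sin_int_mul_pi]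
  simp

theorem two_mul_integral_one_sub_mul_cos_mul_cos (n x : ℝ) :
    2 * ∫ t in (0 : ℝ)..1, 2 * (1 - t) * Real.cos (2 * Real.pi * n * t) *
      Real.cos (2 * Real.pi * x * t) = fejer (x - n) + fejer (x + n) := by
  rw [← integral_one_sub_mul_cos, ← integral_one_sub_mul_cos, ← mul_add,
    ← intervalIntegral.integral_add (Continuous.intervalIntegrable (by fun_prop) _ _)
    (Continuous.intervalIntegrable (by fun_prop) _ _)]
  congr 1
  refine intervalIntegral.integral_congr fun t _ => ?_
  rw [show 2 * Real.pi * (x - n) * t = 2 * Real.pi * x * t - 2 * Real.pi * n * t by ring,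
    show 2 * Real.pi * (x + n) * t = 2 * Real.pi * x * t + 2 * Real.pi * n * t by ring,
    Real.cos_sub, Real.cos_add]
  ring

theorem two_mul_integral_sin_mul_cos (n x : ℝ) :
    2 * ∫ t in (0 : ℝ)..1, Real.sin (2 * Real.pi * n * t) * Real.cos (2 * Real.pi * x * t) =
      Real.pi * ((x + n) * fejer (x + n) - (x - n) * fejer (x - n)) := by
  rw [mul_sub, ← integral_sin_two_pi_mul, ← integral_sin_two_pi_mul,
    ← intervalIntegral.integral_sub (Continuous.intervalIntegrable (by fun_prop) _ _)
    (Continuous.intervalIntegrable (by fun_prop) _ _), ← intervalIntegral.integral_const_mul]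
  refine intervalIntegral.integral_congr fun t _ => ?_
  rw [show 2 * Real.pi * (x - n) * t = 2 * Real.pi * x * t - 2 * Real.pi * n * t by ring,
    show 2 * Real.pi * (x + n) * t = 2 * Real.pi * x * t + 2 * Real.pi * n * t by ring,
    Real.sin_sub, Real.sin_add]
  ring

/-- Summation over the nonzero integers, `n` and `-n` together. -/
theorem hasSum_ne_zero_int {g : ℤ → ℝ} (h1 : Summable fun n : ℕ => g (n + 1))
    (h2 : Summable fun n : ℕ => g (-(n + 1))) :
    HasSum (fun k : {k : ℤ // k ≠ 0} => g k) (∑' n : ℕ, (g (n + 1) + g (-(n + 1)))) := by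
  have e1 : ∀ n : ℕ, ({k : ℤ | k ≠ 0}.indicator g) (n + 1) = g (n + 1) := fun n =>
    indicator_of_mem (by simp only [mem_ofPred_eq]; omega) g
  have e2 : ∀ n : ℕ, ({k : ℤ | k ≠ 0}.indicator g) (-(n + 1)) = g (-(n + 1)) := fun n =>
    indicator_of_mem (by simp only [mem_ofPred_eq]; omega) g
  have h := HasSum.of_add_one_of_neg_add_one (f := {k : ℤ | k ≠ 0}.indicator g)
    (m := ∑' n : ℕ, g (n + 1)) (m' := ∑' n : ℕ, g (-(n + 1)))
    (by simpa only [e1] using h1.hasSum) (by simpa only [e2] using h2.hasSum)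
  rw [indicator_of_notMem (by simp), add_zero, ← h1.tsum_add h2] at h
  exact hasSum_subtype_iff_indicator.2 h

namespace IsCMTower

variable {F : ℕ → ℝ → ℝ}

theorem continuous_lineDual (hF : IsCMTower F) (hs : Summable (majorant F)) :
    Continuous (lineDual F) := by
  have h1 : Continuous fun t : ℝ =>
      ∑' k : ℕ, F 0 (((k : ℝ) + 1) ^ 2) * Real.cos (2 * Real.pi * (k + 1) * t) :=
    continuous_tsum (fun k => by fun_prop) hs fun k t =>
      (abs_mul_cos_le _ _).trans (hF.value_le_majorant k (four_mul_sq_div_sq_pi_le k))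
  have h2 : Continuous fun t : ℝ => ∑' k : ℕ,
      F 1 (((k : ℝ) + 1) ^ 2) * (2 * (k + 1)) * Real.sin (2 * Real.pi * (k + 1) * t) :=
    continuous_tsum (fun k => by fun_prop) hs fun k t =>
      (abs_mul_sin_le _ _).trans (hF.deriv_le k)
  unfold lineDual
  fun_prop

/-- The cosine transform of `lineDual`, term by term. -/
theorem two_mul_integral_lineDual (hF : IsCMTower F) (hs : Summable (majorant F)) (x : ℝ) :
    2 * ∫ t in (0 : ℝ)..1, lineDual F t * Real.cos (2 * Real.pi * x * t) =
      lineOrigin F * fejer x + ∑' k : ℕ, (F 0 ((k + 1) ^ 2) *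
        (fejer (x - (k + 1)) + fejer (x + (k + 1))) + F 1 ((k + 1) ^ 2) * (2 * (k + 1)) *
        ((x - (k + 1)) * fejer (x - (k + 1)) - (x + (k + 1)) * fejer (x + (k + 1)))) := by
  set T : ℕ → ℝ → ℝ := fun k t =>
    F 0 ((k + 1) ^ 2) * (2 * (1 - t) * Real.cos (2 * Real.pi * (k + 1) * t) *
      Real.cos (2 * Real.pi * x * t)) - F 1 ((k + 1) ^ 2) * (2 * (k + 1)) / Real.pi *
      (Real.sin (2 * Real.pi * (k + 1) * t) * Real.cos (2 * Real.pi * x * t)) with hT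
  have hsumcos : ∀ t : ℝ, Summable fun k : ℕ =>
      F 0 (((k : ℝ) + 1) ^ 2) * Real.cos (2 * Real.pi * (k + 1) * t) := fun t =>
    hs.of_norm_bounded fun k =>
      (abs_mul_cos_le _ _).trans (hF.value_le_majorant k (four_mul_sq_div_sq_pi_le k))
  have hsumsin : ∀ t : ℝ, Summable fun k : ℕ =>
      F 1 (((k : ℝ) + 1) ^ 2) * (2 * (k + 1)) * Real.sin (2 * Real.pi * (k + 1) * t) := fun t =>
    hs.of_norm_bounded fun k => (abs_mul_sin_le _ _).trans (hF.deriv_le k)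
  have hpoint : ∀ t : ℝ, HasSum (fun k => T k t) (lineDual F t * Real.cos (2 * Real.pi * x * t) -
      lineOrigin F * ((1 - t) * Real.cos (2 * Real.pi * x * t))) := by
    intro t
    have h1 := (hsumcos t).hasSum.mul_left (2 * (1 - t) * Real.cos (2 * Real.pi * x * t))
    have h2 := (hsumsin t).hasSum.mul_left (1 / Real.pi * Real.cos (2 * Real.pi * x * t))
    have e1 : (fun k => T k t) = fun k : ℕ => 2 * (1 - t) * Real.cos (2 * Real.pi * x * t) *
        (F 0 (((k : ℝ) + 1) ^ 2) * Real.cos (2 * Real.pi * (k + 1) * t)) -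
        1 / Real.pi * Real.cos (2 * Real.pi * x * t) *
        (F 1 (((k : ℝ) + 1) ^ 2) * (2 * (k + 1)) * Real.sin (2 * Real.pi * (k + 1) * t)) := by
      funext k
      simp only [hT]
      ring
    rw [e1]
    have e2 := h1.sub h2
    rwa [show 2 * (1 - t) * Real.cos (2 * Real.pi * x * t) *
      ∑' k : ℕ, F 0 (((k : ℝ) + 1) ^ 2) * Real.cos (2 * Real.pi * (k + 1) * t) -
      1 / Real.pi * Real.cos (2 * Real.pi * x * t) * ∑' k : ℕ,
      F 1 (((k : ℝ) + 1) ^ 2) * (2 * (k + 1)) * Real.sin (2 * Real.pi * (k + 1) * t) =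
      lineDual F t * Real.cos (2 * Real.pi * x * t) -
      lineOrigin F * ((1 - t) * Real.cos (2 * Real.pi * x * t)) by
        rw [lineDual]; ring] at e2
  have hint := intervalIntegral.hasSum_integral_of_dominated_convergence
    (μ := volume) (a := (0 : ℝ)) (b := 1) (F := T)
    (f := fun t => lineDual F t * Real.cos (2 * Real.pi * x * t) -
      lineOrigin F * ((1 - t) * Real.cos (2 * Real.pi * x * t)))
    (fun k _ => 3 * majorant F k)
    (fun k => Continuous.aestronglyMeasurable (by simp only [hT]; fun_prop))
    (fun k => Eventually.of_forall fun t ht => by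
      rw [uIoc_of_le zero_le_one] at ht
      have h1 : |F 0 (((k : ℝ) + 1) ^ 2) * (2 * (1 - t) * Real.cos (2 * Real.pi * (k + 1) * t) *
          Real.cos (2 * Real.pi * x * t))| ≤ 2 * majorant F k := by
        have h0 := hF.value_le_majorant k (four_mul_sq_div_sq_pi_le k)
        rw [← mul_assoc]
        refine (abs_mul_cos_le _ _).trans ?_
        rw [← mul_assoc]
        refine (abs_mul_cos_le _ _).trans ?_
        rw [abs_mul, abs_of_nonneg (by linarith [ht.2] : 0 ≤ 2 * (1 - t))]
        nlinarith [abs_nonneg (F 0 (((k : ℝ) + 1) ^ 2)), ht.1, hF.majorant_nonneg k]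
      have h2 : |F 1 (((k : ℝ) + 1) ^ 2) * (2 * (k + 1)) / Real.pi *
          (Real.sin (2 * Real.pi * (k + 1) * t) * Real.cos (2 * Real.pi * x * t))| ≤
          majorant F k := by
        rw [← mul_assoc]
        refine (abs_mul_cos_le _ _).trans ((abs_mul_sin_le _ _).trans ?_)
        rw [abs_div, abs_of_pos Real.pi_pos]
        refine (div_le_self (abs_nonneg _) (by linarith [Real.pi_gt_three])).trans (hF.deriv_le k)
      calc ‖T k t‖ ≤ _ := abs_sub _ _
        _ ≤ _ := by linarith)
    (Eventually.of_forall fun t _ => hs.mul_left 3)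
    (by simp)
    (Eventually.of_forall fun t _ => hpoint t)
  have hcl := hF.continuous_lineDual hs
  rw [intervalIntegral.integral_sub (Continuous.intervalIntegrable (by fun_prop) _ _)
    (Continuous.intervalIntegrable (by fun_prop) _ _), intervalIntegral.integral_const_mul] at hint
  have h2 := hint.mul_left 2
  have hterm : ∀ k, 2 * ∫ t in (0 : ℝ)..1, T k t = F 0 ((k + 1) ^ 2) *
        (fejer (x - (k + 1)) + fejer (x + (k + 1))) + F 1 ((k + 1) ^ 2) * (2 * (k + 1)) *
        ((x - (k + 1)) * fejer (x - (k + 1)) - (x + (k + 1)) * fejer (x + (k + 1))) := by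
    intro k
    have e1 := two_mul_integral_one_sub_mul_cos_mul_cos (k + 1) x
    have e2 := two_mul_integral_sin_mul_cos (k + 1) x
    simp only [hT]
    rw [intervalIntegral.integral_sub (Continuous.intervalIntegrable (by fun_prop) _ _)
      (Continuous.intervalIntegrable (by fun_prop) _ _), intervalIntegral.integral_const_mul,
      intervalIntegral.integral_const_mul, ← e1, mul_sub, mul_left_comm, mul_left_comm 2, e2,
      sub_eq_add_neg, sub_eq_add_neg]
    rw [add_right_inj]
    field_simp
    ring
  simp only [hterm] at h2
  rw [h2.tsum_eq, ← integral_one_sub_mul_cos x]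
  ring

/-- The Fourier transform of the interpolant on the line, an even function. Truncating `|t|` at `1`
makes it vanish for `1 ≤ |t|`, since `lineDual F 1 = 0`. -/
def lineTransform (F : ℕ → ℝ → ℝ) (t : ℝ) : ℝ := lineDual F (min |t| 1)

theorem continuous_lineTransform (hF : IsCMTower F) (hs : Summable (majorant F)) :
    Continuous (lineTransform F) :=
  (hF.continuous_lineDual hs).comp (by fun_prop)

theorem lineTransform_nonneg (hF : IsCMTower F) (hs : Summable (majorant F)) (t : ℝ) :
    0 ≤ lineTransform F t :=
  hF.lineDual_nonneg hs ⟨le_min (abs_nonneg t) zero_le_one, min_le_right _ _⟩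

theorem lineTransform_eq_zero (F : ℕ → ℝ → ℝ) {t : ℝ} (ht : 1 ≤ |t|) : lineTransform F t = 0 := by
  rw [lineTransform, min_eq_right ht, lineDual_one]

theorem tsupport_lineTransform_subset (F : ℕ → ℝ → ℝ) :
    tsupport (lineTransform F) ⊆ Icc (-1) 1 := by
  refine closure_minimal (fun t ht => ?_) isClosed_Icc
  refine abs_le.1 ?_
  by_contra! h
  exact ht (lineTransform_eq_zero F h.le)

theorem integral_lineTransform_mul_exp (hF : IsCMTower F) (hs : Summable (majorant F)) (x : ℝ) :
    ∫ t : ℝ, (lineTransform F t : ℂ) * Complex.exp (2 * Real.pi * Complex.I * x * t) =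
      ((2 * ∫ t in (0 : ℝ)..1, lineDual F t * Real.cos (2 * Real.pi * x * t) : ℝ) : ℂ) := by
  set G : ℝ → ℂ := fun t => (lineTransform F t : ℂ) *
    Complex.exp (2 * Real.pi * Complex.I * x * t) with hG
  have hcont : Continuous G := by
    have := hF.continuous_lineTransform hs
    fun_prop
  have hsupp : Function.support G ⊆ Ioc (-1) 1 := by
    intro t ht
    by_contra h
    refine ht ?_
    have : 1 ≤ |t| := by
      by_contra! h'
      rw [abs_lt] at h'
      exact h ⟨h'.1, h'.2.le⟩
    simp only [hG, lineTransform_eq_zero F this, Complex.ofReal_zero, zero_mul]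
  rw [← intervalIntegral.integral_eq_integral_of_support_subset hsupp,
    ← intervalIntegral.integral_add_adjacent_intervals (b := 0)
    (hcont.intervalIntegrable _ _) (hcont.intervalIntegrable _ _)]
  have hneg : ∫ t in (-1 : ℝ)..0, G t = ∫ t in (0 : ℝ)..1, G (-t) := by
    rw [intervalIntegral.integral_comp_neg]; simp
  rw [hneg, ← intervalIntegral.integral_add
    (Continuous.intervalIntegrable (by fun_prop) _ _) (hcont.intervalIntegrable _ _),
    ← intervalIntegral.integral_const_mul, ← intervalIntegral.integral_ofReal]
  refine intervalIntegral.integral_congr fun t ht => ?_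
  rw [uIcc_of_le zero_le_one] at ht
  have e1 : lineTransform F t = lineDual F t := by
    rw [lineTransform, abs_of_nonneg ht.1, min_eq_left ht.2]
  have e2 : lineTransform F (-t) = lineDual F t := by
    rw [← e1, lineTransform, lineTransform, abs_neg]
  simp only [hG, e1, e2]
  push_cast
  rw [Complex.cos]
  ring_nf

end IsCMTower

/-! ### The linear programming bound -/

theorem summable_exp_neg_sq_div {c L : ℝ} (hc : 0 < c) (hL : 0 < L) (v : ℝ) :
    Summable fun m : ℤ => Real.exp (-(m * L + v) ^ 2 / c) := by
  have h := ((summable_jacobiTheta₂_term_iff ((L * v / (Real.pi * c) : ℝ) * Complex.I)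
    ((L ^ 2 / (Real.pi * c) : ℝ) * Complex.I)).2 (by
      rw [Complex.im_ofReal_mul, Complex.I_im, mul_one]; positivity)).norm
  refine (h.mul_left (Real.exp (-v ^ 2 / c))).congr fun m => ?_
  rw [norm_jacobiTheta₂_term, ← Real.exp_add]
  congr 1
  simp only [Complex.mul_im, Complex.ofReal_re, Complex.I_im, Complex.ofReal_im, Complex.I_re,
    mul_one, mul_zero, add_zero]
  field_simp
  ring

/-- Poisson summation for a modulated Gaussian over the shifted lattice `Lℤ + v`. -/
theorem tsum_exp_mul_gaussian {c L : ℝ} (hc : 0 < c) (hL : 0 < L) (v t : ℝ) :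
    ∑' m : ℤ, Complex.exp (2 * Real.pi * Complex.I * ((m * L + v : ℝ) : ℂ) * t) *
      (Real.exp (-(m * L + v) ^ 2 / c) : ℂ) =
    ((√(Real.pi * c) / L : ℝ) : ℂ) * ∑' n : ℤ, Complex.exp (2 * Real.pi * Complex.I * n * v / L) *
      (Real.exp (-Real.pi ^ 2 * c * (n / L - t) ^ 2) : ℂ) := by
  have hLc : (L : ℂ) ≠ 0 := by exact_mod_cast hL.ne'
  have hcc : (c : ℂ) ≠ 0 := by exact_mod_cast hc.ne'
  have hpi : (Real.pi : ℂ) ≠ 0 := by exact_mod_cast Real.pi_ne_zero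
  have ha : 0 < L ^ 2 / (Real.pi * c) := by positivity
  have h := Complex.tsum_exp_neg_quadratic (a := ((L ^ 2 / (Real.pi * c) : ℝ) : ℂ))
    (by rwa [Complex.ofReal_re]) (-(L * v) / (Real.pi * c) + Complex.I * t * L)
  have hpow : (1 : ℂ) / ((L ^ 2 / (Real.pi * c) : ℝ) : ℂ) ^ (1 / 2 : ℂ) =
      ((√(Real.pi * c) / L : ℝ) : ℂ) := by
    rw [show (1 / 2 : ℂ) = ((1 / 2 : ℝ) : ℂ) by push_cast; rfl, ← Complex.ofReal_cpow ha.le,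
      ← Real.sqrt_eq_rpow, Real.sqrt_div' _ (by positivity), Real.sqrt_sq hL.le]
    push_cast
    rw [one_div_div]
  rw [hpow] at h
  have hl : ∀ m : ℤ, Complex.exp (2 * Real.pi * Complex.I * ((m * L + v : ℝ) : ℂ) * t) *
      (Real.exp (-(m * L + v) ^ 2 / c) : ℂ) =
      Complex.exp (2 * Real.pi * Complex.I * t * v - v ^ 2 / c) *
      Complex.exp (-Real.pi * ((L ^ 2 / (Real.pi * c) : ℝ) : ℂ) * m ^ 2 +
        2 * Real.pi * (-(L * v) / (Real.pi * c) + Complex.I * t * L) * m) := by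
    intro m
    rw [Complex.ofReal_exp, ← Complex.exp_add, ← Complex.exp_add]
    congr 1
    push_cast
    field_simp
    ring
  have hr : ∀ n : ℤ, Complex.exp (2 * Real.pi * Complex.I * n * v / L) *
      (Real.exp (-Real.pi ^ 2 * c * (n / L - t) ^ 2) : ℂ) =
      Complex.exp (2 * Real.pi * Complex.I * t * v - v ^ 2 / c) *
      Complex.exp (-Real.pi / ((L ^ 2 / (Real.pi * c) : ℝ) : ℂ) *
        (n + Complex.I * (-(L * v) / (Real.pi * c) + Complex.I * t * L)) ^ 2) := by
    intro n
    rw [Complex.ofReal_exp, ← Complex.exp_add, ← Complex.exp_add]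
    congr 1
    push_cast
    field_simp
    ring_nf
    simp only [Complex.I_sq, show Complex.I ^ 4 = 1 from Complex.I_pow_four,
      show Complex.I ^ 3 = -Complex.I from Complex.I_pow_three]
    ring
  simp only [hl, hr, tsum_mul_left, h]
  ring

namespace PeriodicConfig

/-- The pair sum of modulated Gaussians dominates its contribution from the zero frequency, because
the contribution from the frequency `n / L` is a multiple of `|∑ j, exp (2 π i n v j / L)| ^ 2`. -/
theorem le_re_sum_gaussian (C : PeriodicConfig) {c : ℝ} (hc : 0 < c) (t : ℝ) :
    (C.N : ℝ) ^ 2 * (√(Real.pi * c) / C.L * Real.exp (-Real.pi ^ 2 * c * t ^ 2)) ≤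
    (∑ j : Fin C.N, ∑ k : Fin C.N, ∑' m : ℤ,
      Complex.exp (2 * Real.pi * Complex.I * ((m * C.L + (C.v j - C.v k) : ℝ) : ℂ) * t) *
      (Real.exp (-(m * C.L + (C.v j - C.v k)) ^ 2 / c) : ℂ)).re := by
  have hL := C.L_pos
  set g : ℤ → ℝ := fun n => Real.exp (-Real.pi ^ 2 * c * (n / C.L - t) ^ 2) with hg
  set S : ℤ → ℂ := fun n => ∑ j : Fin C.N, Complex.exp (2 * Real.pi * Complex.I * n * C.v j / C.L)
    with hS
  have hgs : Summable g := by
    refine (summable_exp_neg_sq_div (c := 1 / (Real.pi ^ 2 * c)) (by positivity)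
      (inv_pos.2 hL) (-t)).congr fun n => ?_
    simp only [hg]
    congr 1
    field_simp
    ring
  have hgs' : ∀ w : ℝ, Summable fun n : ℤ =>
      Complex.exp (2 * Real.pi * Complex.I * n * (w : ℂ) / C.L) * (g n : ℂ) := by
    intro w
    refine hgs.of_norm_bounded fun n => ?_
    rw [norm_mul, show 2 * Real.pi * Complex.I * n * (w : ℂ) / C.L =
      ((2 * Real.pi * n * w / C.L : ℝ) : ℂ) * Complex.I by push_cast; ring,
      Complex.norm_exp_ofReal_mul_I, one_mul, Complex.norm_real, Real.norm_of_nonneg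
      (Real.exp_pos _).le]
  have hsum : HasSum (fun n : ℤ => ((g n * Complex.normSq (S n) : ℝ) : ℂ))
      (∑ j : Fin C.N, ∑ k : Fin C.N, ∑' n : ℤ,
        Complex.exp (2 * Real.pi * Complex.I * n * ((C.v j - C.v k : ℝ) : ℂ) / C.L) *
          (g n : ℂ)) := by
    have h1 := hasSum_sum (s := Finset.univ) fun (j : Fin C.N) _ =>
      hasSum_sum (s := Finset.univ) fun (k : Fin C.N) _ => (hgs' (C.v j - C.v k)).hasSum
    convert! h1 using 2 with n
    push_cast
    rw [← Complex.mul_conj, hS, map_sum, Finset.sum_mul_sum, Finset.mul_sum]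
    refine Finset.sum_congr rfl fun j _ => ?_
    rw [Finset.mul_sum]
    refine Finset.sum_congr rfl fun k _ => ?_
    rw [← Complex.exp_conj, ← Complex.exp_add, mul_comm]
    congr 2
    simp only [map_div₀, map_mul, Complex.conj_ofReal, Complex.conj_I, map_ofNat, map_intCast]
    ring
  have hre := Complex.hasSum_re hsum
  have h0 := le_hasSum hre 0 fun n _ => by
    rw [Complex.ofReal_re]
    exact mul_nonneg (Real.exp_pos _).le (Complex.normSq_nonneg _)
  have hg0 : g 0 = Real.exp (-Real.pi ^ 2 * c * t ^ 2) := by simp [hg]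
  have hS0 : S 0 = C.N := by simp [hS]
  rw [Complex.ofReal_re, hg0, hS0, Complex.normSq_natCast] at h0
  simp only [tsum_exp_mul_gaussian hc hL, ← Finset.mul_sum]
  rw [Complex.re_ofReal_mul]
  calc _ = √(Real.pi * c) / C.L * (Real.exp (-Real.pi ^ 2 * c * t ^ 2) * (C.N * C.N)) := by ring
    _ ≤ _ := mul_le_mul_of_nonneg_left h0 (by positivity)

end PeriodicConfig

/-- Gaussians of integral `1` that concentrate at `0`. -/
theorem tendsto_integral_gaussian_mul {g : ℝ → ℝ} (hg : Continuous g) (hgi : Integrable g) :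
    Tendsto (fun c : ℝ => ∫ t, g t * (√(Real.pi * c) * Real.exp (-Real.pi ^ 2 * c * t ^ 2))) atTop
      (nhds (g 0)) := by
  have h := Real.tendsto_integral_gaussian_smul' (V := ℝ) (E := ℂ) (f := fun t => (g t : ℂ))
    hgi.ofReal (v := 0) (Complex.continuous_ofReal.comp hg).continuousAt
  have h2 := (Complex.continuous_re.tendsto _).comp h
  rw [Complex.ofReal_re] at h2
  refine h2.congr' ?_
  filter_upwards [eventually_gt_atTop 0] with c hc
  rw [Function.comp_apply, ← Complex.ofReal_re (∫ t, g t * _), ← integral_complex_ofReal]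
  congr 1
  refine integral_congr_ae (Eventually.of_forall fun t => ?_)
  have e1 : ((Real.pi : ℂ) * c) ^ ((Module.finrank ℝ ℝ : ℂ) / 2) = ((√(Real.pi * c) : ℝ) : ℂ) := by
    rw [Module.finrank_self, Real.sqrt_eq_rpow, Complex.ofReal_cpow (by positivity)]
    push_cast
    rfl
  have e2 : ((‖(0 : ℝ) - t‖ : ℝ) : ℂ) ^ 2 = (t : ℂ) ^ 2 := by
    rw [zero_sub, norm_neg, ← Complex.ofReal_pow, Real.norm_eq_abs, sq_abs, Complex.ofReal_pow]
  beta_reduce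
  rw [e1, e2, smul_eq_mul]
  push_cast
  ring

namespace PeriodicConfig

theorem eq_zero_iff (C : PeriodicConfig) (j k : Fin C.N) (m : ℤ) :
    m * C.L + C.v j - C.v k = 0 ↔ j = k ∧ m = 0 := by
  have hL := C.L_pos.ne'
  constructor
  · intro h
    by_cases hjk : j = k
    · subst hjk
      have h' : (m : ℝ) * C.L = 0 := by linarith
      exact ⟨rfl, by exact_mod_cast (mul_eq_zero.1 h').resolve_right hL⟩
    · exact absurd (by push_cast; linarith) (C.disjoint j k hjk (-m))
  · rintro ⟨rfl, rfl⟩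
    simp

/-- The linear programming bound for periodic configurations on the line. Weighting the distances
by a wide Gaussian makes all sums converge absolutely, so no decay of `h` is needed. -/
theorem linear_programming_bound {p h hhat : ℝ → ℝ} (hcont : Continuous hhat)
    (hsupp : HasCompactSupport hhat) (hnonneg : ∀ t, 0 ≤ hhat t)
    (hfour : ∀ x : ℝ, (h x : ℂ) =
      ∫ t : ℝ, (hhat t : ℂ) * Complex.exp (2 * Real.pi * Complex.I * x * t))
    (hp : ∀ x, x ≠ 0 → 0 ≤ p x) (hle : ∀ x, x ≠ 0 → h x ≤ p x) (C : PeriodicConfig) :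
    ENNReal.ofReal (C.density * hhat 0 - h 0) ≤ (C.N : ℝ≥0∞)⁻¹ * ∑ j : Fin C.N, ∑ k : Fin C.N,
      ∑' m : {m : ℤ // m * C.L + C.v j - C.v k ≠ 0},
        ENNReal.ofReal (p ((m : ℤ) * C.L + C.v j - C.v k)) := by
  have hL := C.L_pos
  have hN : (0 : ℝ) < C.N := by exact_mod_cast C.N_pos
  have hint : Integrable hhat := hcont.integrable_of_hasCompactSupport hsupp
  by_cases hfin : ∀ j k : Fin C.N, ∑' m : {m : ℤ // m * C.L + C.v j - C.v k ≠ 0},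
        ENNReal.ofReal (p ((m : ℤ) * C.L + C.v j - C.v k)) ≠ ⊤
  swap
  · push Not at hfin
    obtain ⟨j, k, hjk⟩ := hfin
    rw [ENNReal.sum_eq_top.2 ⟨j, Finset.mem_univ j, ENNReal.sum_eq_top.2
      ⟨k, Finset.mem_univ k, hjk⟩⟩, ENNReal.mul_top (by simp)]
    exact le_top
  set E : Fin C.N → Fin C.N → ℝ := fun j k =>
    ∑' m : {m : ℤ // m * C.L + C.v j - C.v k ≠ 0}, p ((m : ℤ) * C.L + C.v j - C.v k) with hE
  have hps : ∀ j k : Fin C.N, Summable fun m : {m : ℤ // m * C.L + C.v j - C.v k ≠ 0} =>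
      p ((m : ℤ) * C.L + C.v j - C.v k) := by
    intro j k
    refine (ENNReal.summable_toReal (hfin j k)).congr fun m => ?_
    rw [ENNReal.toReal_ofReal (hp _ m.2)]
  have hpE : ∀ j k : Fin C.N, ∑' m : {m : ℤ // m * C.L + C.v j - C.v k ≠ 0},
        ENNReal.ofReal (p ((m : ℤ) * C.L + C.v j - C.v k)) = ENNReal.ofReal (E j k) :=
    fun j k => (ENNReal.ofReal_tsum_of_nonneg (fun m => hp _ m.2) (hps j k)).symm
  have hE0 : ∀ j k, 0 ≤ E j k := fun j k => tsum_nonneg fun m => hp _ m.2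
  simp only [hpE]
  rw [Finset.sum_congr rfl fun j _ => (ENNReal.ofReal_sum_of_nonneg fun k _ => hE0 j k).symm,
    ← ENNReal.ofReal_sum_of_nonneg fun j _ => Finset.sum_nonneg fun k _ => hE0 j k,
    ← ENNReal.ofReal_natCast, ← ENNReal.ofReal_inv_of_pos hN,
    ← ENNReal.ofReal_mul (inv_nonneg.2 hN.le)]
  refine ENNReal.ofReal_le_ofReal ?_
  have hbound : ∀ (c w : ℝ) (m : ℤ) (t : ℝ),
      ‖Complex.exp (2 * Real.pi * Complex.I * ((m * C.L + w : ℝ) : ℂ) * t) *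
        (Real.exp (-(m * C.L + w) ^ 2 / c) : ℂ)‖ ≤ Real.exp (-(m * C.L + w) ^ 2 / c) := by
    intro c w m t
    rw [norm_mul, show 2 * Real.pi * Complex.I * ((m * C.L + w : ℝ) : ℂ) * t =
      ((2 * Real.pi * (m * C.L + w) * t : ℝ) : ℂ) * Complex.I by push_cast; ring,
      Complex.norm_exp_ofReal_mul_I, one_mul, Complex.norm_real,
      Real.norm_of_nonneg (Real.exp_pos _).le]
  have hΨcont : ∀ c : ℝ, 0 < c → ∀ w : ℝ, Continuous fun t : ℝ => ∑' m : ℤ,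
      Complex.exp (2 * Real.pi * Complex.I * ((m * C.L + w : ℝ) : ℂ) * t) *
        (Real.exp (-(m * C.L + w) ^ 2 / c) : ℂ) := fun c hc w =>
    continuous_tsum (fun m => by fun_prop) (summable_exp_neg_sq_div hc hL w)
      fun m t => hbound c w m t
  have hΨint : ∀ c : ℝ, 0 < c → ∀ w : ℝ, Integrable fun t : ℝ => (hhat t : ℂ) * ∑' m : ℤ,
      Complex.exp (2 * Real.pi * Complex.I * ((m * C.L + w : ℝ) : ℂ) * t) *
        (Real.exp (-(m * C.L + w) ^ 2 / c) : ℂ) := by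
    intro c hc w
    refine Continuous.integrable_of_hasCompactSupport
      ((Complex.continuous_ofReal.comp hcont).mul (hΨcont c hc w)) ?_
    exact (hsupp.comp_left Complex.ofReal_zero).mul_right
  -- the Gaussian-weighted sum over the differences of classes `j` and `k`, as an integral
  have hswap : ∀ c : ℝ, 0 < c → ∀ j k : Fin C.N,
      HasSum (fun m : ℤ => h (m * C.L + (C.v j - C.v k)) *
        Real.exp (-(m * C.L + (C.v j - C.v k)) ^ 2 / c))
      (∫ t : ℝ, (hhat t : ℂ) * ∑' m : ℤ,
        Complex.exp (2 * Real.pi * Complex.I * ((m * C.L + (C.v j - C.v k) : ℝ) : ℂ) * t) *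
        (Real.exp (-(m * C.L + (C.v j - C.v k)) ^ 2 / c) : ℂ)).re := by
    intro c hc j k
    generalize C.v j - C.v k = w
    have hsum := summable_exp_neg_sq_div hc hL w
    have key := hasSum_integral_of_dominated_convergence (μ := volume)
      (F := fun (m : ℤ) (t : ℝ) => (hhat t : ℂ) *
        (Complex.exp (2 * Real.pi * Complex.I * ((m * C.L + w : ℝ) : ℂ) * t) *
        (Real.exp (-(m * C.L + w) ^ 2 / c) : ℂ)))
      (fun m t => |hhat t| * Real.exp (-(m * C.L + w) ^ 2 / c))
      (fun m => Continuous.aestronglyMeasurable (by fun_prop))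
      (fun m => Eventually.of_forall fun t => by
        rw [norm_mul, Complex.norm_real, Real.norm_eq_abs]
        exact mul_le_mul_of_nonneg_left (hbound c w m t) (abs_nonneg _))
      (Eventually.of_forall fun t => hsum.mul_left _)
      (by simp only [tsum_mul_left]; exact hint.abs.mul_const _)
      (Eventually.of_forall fun t =>
        (hsum.of_norm_bounded fun m => hbound c w m t).hasSum.mul_left _)
    have hterm : ∀ m : ℤ, ∫ t : ℝ, (hhat t : ℂ) *
        (Complex.exp (2 * Real.pi * Complex.I * ((m * C.L + w : ℝ) : ℂ) * t) *
        (Real.exp (-(m * C.L + w) ^ 2 / c) : ℂ)) =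
        ((h (m * C.L + w) * Real.exp (-(m * C.L + w) ^ 2 / c) : ℝ) : ℂ) := by
      intro m
      simp only [← mul_assoc]
      rw [integral_mul_const, ← hfour, Complex.ofReal_mul]
    simp only [hterm] at key
    have key2 := Complex.hasSum_re key
    simpa only [Complex.ofReal_re] using key2
  -- `h ≤ p` and the weight is at most `1`; only the pairs `j = k` contain the difference `0`
  have hupper : ∀ c : ℝ, 0 < c → ∀ j k : Fin C.N,
      ∑' m : ℤ, h (m * C.L + (C.v j - C.v k)) *
        Real.exp (-(m * C.L + (C.v j - C.v k)) ^ 2 / c) ≤ E j k + if j = k then h 0 else 0 := by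
    intro c hc j k
    set P : ℤ → ℝ := {m : ℤ | m * C.L + C.v j - C.v k ≠ 0}.indicator
      fun m => p (m * C.L + C.v j - C.v k) with hP
    have hPsum : HasSum P (E j k) := hasSum_subtype_iff_indicator.1 (hps j k).hasSum
    have hQsum : HasSum (fun m : ℤ => if m = 0 then (if j = k then h 0 else 0) else 0)
        (if j = k then h 0 else 0) := hasSum_ite_eq 0 _
    refine hasSum_le (fun m => ?_) (hswap c hc j k).summable.hasSum (hPsum.add hQsum)
    rw [← add_sub_assoc]
    have hexp : Real.exp (-(m * C.L + C.v j - C.v k) ^ 2 / c) ≤ 1 := by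
      rw [Real.exp_le_one_iff, neg_div]
      exact neg_nonpos.2 (by positivity)
    by_cases hm : (m : ℝ) * C.L + C.v j - C.v k = 0
    · have hjm := (C.eq_zero_iff j k m).1 hm
      rw [hP, indicator_of_notMem (by simpa using hm), hm, if_pos hjm.2, if_pos hjm.1]
      simp
    · have hzero : (if m = 0 then (if j = k then h 0 else 0) else 0) = 0 := by
        have := mt (C.eq_zero_iff j k m).2 hm
        split_ifs <;> tauto
      rw [hP, indicator_of_mem (by simpa using hm), hzero, add_zero]
      calc _ ≤ p (m * C.L + C.v j - C.v k) * Real.exp (-(m * C.L + C.v j - C.v k) ^ 2 / c) :=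
            mul_le_mul_of_nonneg_right (hle _ hm) (Real.exp_pos _).le
        _ ≤ _ := mul_le_of_le_one_right (hp _ hm) hexp
  -- the weighted pair sums, compared with the contribution of the zero frequency
  have hmain : ∀ c : ℝ, 0 < c → (C.N : ℝ) ^ 2 / C.L *
      ∫ t, hhat t * (√(Real.pi * c) * Real.exp (-Real.pi ^ 2 * c * t ^ 2)) ≤
      ∑ j, ∑ k, E j k + C.N * h 0 := by
    intro c hc
    set Ψ : Fin C.N → Fin C.N → ℝ → ℂ := fun j k t => ∑' m : ℤ,
      Complex.exp (2 * Real.pi * Complex.I * ((m * C.L + (C.v j - C.v k) : ℝ) : ℂ) * t) *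
        (Real.exp (-(m * C.L + (C.v j - C.v k)) ^ 2 / c) : ℂ) with hΨ
    have hI : ∀ j k, Integrable fun t : ℝ => (hhat t : ℂ) * Ψ j k t :=
      fun j k => hΨint c hc (C.v j - C.v k)
    have hI2 : Integrable fun t : ℝ => ∑ j, ∑ k, (hhat t : ℂ) * Ψ j k t :=
      integrable_finsetSum _ fun j _ => integrable_finsetSum _ fun k _ => hI j k
    have h1 : ∑ j, ∑ k, (∫ t : ℝ, (hhat t : ℂ) * Ψ j k t).re =
        ∫ t : ℝ, (∑ j, ∑ k, (hhat t : ℂ) * Ψ j k t).re := by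
      have e := integral_re hI2
      simp only [RCLike.re_eq_complex_re] at e
      rw [e, integral_finsetSum _ fun j _ => integrable_finsetSum _ fun k _ => hI j k,
        Complex.re_sum]
      refine Finset.sum_congr rfl fun j _ => ?_
      rw [integral_finsetSum _ fun k _ => hI j k, Complex.re_sum]
    have h2 : ∑ j, ∑ k, (∫ t : ℝ, (hhat t : ℂ) * Ψ j k t).re ≤
        ∑ j : Fin C.N, ∑ k : Fin C.N, (E j k + if j = k then h 0 else 0) := by
      refine Finset.sum_le_sum fun j _ => Finset.sum_le_sum fun k _ => ?_
      rw [← (hswap c hc j k).tsum_eq]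
      exact hupper c hc j k
    have h3 : ∑ j : Fin C.N, ∑ k : Fin C.N, (E j k + if j = k then h 0 else 0) =
        ∑ j, ∑ k, E j k + C.N * h 0 := by
      simp [Finset.sum_add_distrib]
    rw [← h3]
    refine le_trans ?_ h2
    rw [h1, ← integral_const_mul]
    refine integral_mono ?_ hI2.re fun t => ?_
    · refine Integrable.const_mul (Continuous.integrable_of_hasCompactSupport (by fun_prop) ?_) _
      exact hsupp.mul_right
    · have h4 := C.le_re_sum_gaussian hc t
      have h5 : (∑ j, ∑ k, (hhat t : ℂ) * Ψ j k t).re = hhat t * (∑ j, ∑ k, Ψ j k t).re := by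
        rw [← Complex.re_ofReal_mul, Finset.mul_sum]
        simp only [Finset.mul_sum]
      change _ ≤ (∑ j, ∑ k, (hhat t : ℂ) * Ψ j k t).re
      rw [h5]
      refine le_trans (le_of_eq ?_) (mul_le_mul_of_nonneg_left h4 (hnonneg t))
      ring
  have hlim := (tendsto_integral_gaussian_mul hcont hint).const_mul ((C.N : ℝ) ^ 2 / C.L)
  have hfinal := le_of_tendsto hlim ((eventually_gt_atTop 0).mono hmain)
  rw [density, inv_mul_eq_div, le_div_iff₀ hN]
  calc (C.N / C.L * hhat 0 - h 0) * C.N = (C.N : ℝ) ^ 2 / C.L * hhat 0 - C.N * h 0 := by ring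
    _ ≤ _ := by linarith

end PeriodicConfig

/-! ### Identification with the explicit series -/

section interpolant

variable {f : ℝ → ℝ} {F : ℕ → ℝ → ℝ}

theorem IsCMTower.deriv_eq (hF : IsCMTower F) (hf : F 0 = f) {y : ℝ} (hy : 0 < y) :
    deriv f y = F 1 y := hf ▸ (hF.hasDerivAt 0 y hy).deriv

theorem valueTerm_succ (hf : F 0 = f) (x : ℝ) (n : ℕ) :
    valueTerm f x ((n : ℤ) + 1) = F 0 (((n : ℝ) + 1) ^ 2) * fejer (x - (n + 1)) := by
  simp [valueTerm, radial, hf]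

theorem valueTerm_neg_succ (hf : F 0 = f) (x : ℝ) (n : ℕ) :
    valueTerm f x (-((n : ℤ) + 1)) = F 0 (((n : ℝ) + 1) ^ 2) * fejer (x + (n + 1)) := by
  have : ((-((n : ℤ) + 1) : ℤ) : ℝ) = -((n : ℝ) + 1) := by push_cast; ring
  rw [valueTerm, radial, this, neg_sq, sub_neg_eq_add, hf]

theorem derivTerm_succ (hF : IsCMTower F) (hf : F 0 = f) (x : ℝ) (n : ℕ) :
    derivTerm f x ((n : ℤ) + 1) =
      F 1 (((n : ℝ) + 1) ^ 2) * (2 * (n + 1)) * ((x - (n + 1)) * fejer (x - (n + 1))) := by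
  have : (((n : ℤ) + 1 : ℤ) : ℝ) = (n : ℝ) + 1 := by push_cast; ring
  rw [derivTerm, radialDeriv, this, hF.deriv_eq hf (by positivity)]
  ring

theorem derivTerm_neg_succ (hF : IsCMTower F) (hf : F 0 = f) (x : ℝ) (n : ℕ) :
    derivTerm f x (-((n : ℤ) + 1)) =
      -(F 1 (((n : ℝ) + 1) ^ 2) * (2 * (n + 1)) * ((x + (n + 1)) * fejer (x + (n + 1)))) := by
  have : ((-((n : ℤ) + 1) : ℤ) : ℝ) = -((n : ℝ) + 1) := by push_cast; ring
  rw [derivTerm, radialDeriv, this, neg_sq, sub_neg_eq_add, hF.deriv_eq hf (by positivity)]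
  ring

theorem originTerm_succ (hF : IsCMTower F) (hf : F 0 = f) (n : ℕ) : originTerm f (n + 1) =
    F 0 (((n : ℝ) + 1) ^ 2) + F 1 (((n : ℝ) + 1) ^ 2) * (2 * (n + 1)) * (n + 1) := by
  rw [originTerm, radial, radialDeriv, hF.deriv_eq hf (by positivity), hf]
  push_cast
  ring

theorem summable_value_mul_fejer (hF : IsCMTower F) (hs : Summable (IsCMTower.majorant F))
    (y : ℕ → ℝ) : Summable fun n : ℕ => F 0 (((n : ℝ) + 1) ^ 2) * fejer (y n) :=
  hs.of_norm_bounded fun n => by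
    rw [Real.norm_eq_abs, abs_mul, abs_of_nonneg (fejer_nonneg _)]
    exact (mul_le_of_le_one_right (abs_nonneg _) (fejer_le_one _)).trans
      (hF.value_le_majorant n (four_mul_sq_div_sq_pi_le n))

theorem summable_deriv_mul_fejer (hF : IsCMTower F) (hs : Summable (IsCMTower.majorant F))
    (y : ℕ → ℝ) :
    Summable fun n : ℕ => F 1 (((n : ℝ) + 1) ^ 2) * (2 * (n + 1)) * (y n * fejer (y n)) :=
  hs.of_norm_bounded fun n => by
    rw [Real.norm_eq_abs, abs_mul]
    exact (mul_le_of_le_one_right (abs_nonneg _) (abs_mul_fejer_le_one _)).trans (hF.deriv_le n)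

theorem hasSum_valueTerm (hF : IsCMTower F) (hf : F 0 = f)
    (hs : Summable (IsCMTower.majorant F)) (x : ℝ) :
    HasSum (fun k : {k : ℤ // k ≠ 0} => valueTerm f x k) (∑' n : ℕ, F 0 (((n : ℝ) + 1) ^ 2) *
      (fejer (x - (n + 1)) + fejer (x + (n + 1)))) := by
  have h := hasSum_ne_zero_int (g := valueTerm f x)
    (by simpa only [valueTerm_succ hf] using summable_value_mul_fejer hF hs _)
    (by simpa only [valueTerm_neg_succ hf] using summable_value_mul_fejer hF hs _)
  simpa only [valueTerm_succ hf, valueTerm_neg_succ hf, ← mul_add] using h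

theorem hasSum_derivTerm (hF : IsCMTower F) (hf : F 0 = f)
    (hs : Summable (IsCMTower.majorant F)) (x : ℝ) :
    HasSum (fun k : {k : ℤ // k ≠ 0} => derivTerm f x k)
      (∑' n : ℕ, F 1 (((n : ℝ) + 1) ^ 2) * (2 * (n + 1)) *
      ((x - (n + 1)) * fejer (x - (n + 1)) - (x + (n + 1)) * fejer (x + (n + 1)))) := by
  have h := hasSum_ne_zero_int (g := derivTerm f x)
    (by simpa only [derivTerm_succ hF hf] using
      summable_deriv_mul_fejer hF hs fun n => x - (n + 1))
    (by simpa only [derivTerm_neg_succ hF hf] using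
      (summable_deriv_mul_fejer hF hs fun n => x + (n + 1)).neg)
  simpa only [derivTerm_succ hF hf, derivTerm_neg_succ hF hf, ← sub_eq_add_neg, ← mul_sub] using h

theorem summable_originTerm (hF : IsCMTower F) (hf : F 0 = f)
    (hs : Summable (IsCMTower.majorant F)) : Summable fun n : ℕ => originTerm f (n + 1) := by
  simp only [originTerm_succ hF hf]
  exact (hF.summable_value hs).add (hs.of_norm_bounded fun k => hF.deriv_mul_le k)

theorem interpolant_eq_integral (hF : IsCMTower F) (hf : F 0 = f)
    (hs : Summable (IsCMTower.majorant F)) (x : ℝ) : interpolant f x =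
      2 * ∫ t in (0 : ℝ)..1, IsCMTower.lineDual F t * Real.cos (2 * Real.pi * x * t) := by
  have h1 := (summable_value_mul_fejer hF hs fun n => x - (n + 1)).add
    (summable_value_mul_fejer hF hs fun n => x + (n + 1))
  have h2 := (summable_deriv_mul_fejer hF hs fun n => x - (n + 1)).sub
    (summable_deriv_mul_fejer hF hs fun n => x + (n + 1))
  simp only [← mul_add] at h1
  simp only [← mul_sub] at h2
  rw [hF.two_mul_integral_lineDual hs, h1.tsum_add h2, interpolant,
    (hasSum_valueTerm hF hf hs x).tsum_eq, (hasSum_derivTerm hF hf hs x).tsum_eq,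
    IsCMTower.lineOrigin]
  simp only [originTerm_succ hF hf]
  ring

theorem interpolant_zero (hF : IsCMTower F) (hf : F 0 = f)
    (hs : Summable (IsCMTower.majorant F)) : interpolant f 0 = IsCMTower.lineOrigin F := by
  have h1 : ∀ n : ℕ, fejer ((n : ℝ) + 1) = 0 := fun n => by
    exact_mod_cast fejer_int (k := (n : ℤ) + 1) (by omega)
  have h2 : fejer 0 = 1 := by simp [fejer]
  rw [interpolant_eq_integral hF hf hs, hF.two_mul_integral_lineDual hs]
  simp only [zero_sub, zero_add, fejer_neg, h1, h2]
  simp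

theorem hasSum_apply_sq (hF : IsCMTower F) (hf : F 0 = f)
    (hs : Summable (IsCMTower.majorant F)) :
    HasSum (fun k : {k : ℤ // k ≠ 0} => f (((k : ℤ) : ℝ) ^ 2))
      (IsCMTower.lineTransform F 0 - interpolant f 0) := by
  have e1 : ∀ n : ℕ, f ((((n : ℤ) + 1 : ℤ) : ℝ) ^ 2) = F 0 (((n : ℝ) + 1) ^ 2) := fun n => by
    rw [hf]; push_cast; rfl
  have e2 : ∀ n : ℕ, f (((-((n : ℤ) + 1) : ℤ) : ℝ) ^ 2) = F 0 (((n : ℝ) + 1) ^ 2) := fun n => by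
    rw [← e1, Int.cast_neg, neg_sq]
  have h := hasSum_ne_zero_int (g := fun k : ℤ => f ((k : ℝ) ^ 2))
    (by simpa only [e1] using hF.summable_value hs) (by simpa only [e2] using hF.summable_value hs)
  simp only [e1, e2, ← two_mul, tsum_mul_left] at h
  rw [interpolant_zero hF hf hs, IsCMTower.lineTransform, IsCMTower.lineDual]
  simpa using h

theorem energy_integers (hF : IsCMTower F) (hf : F 0 = f) {a : ℝ}
    (h : HasSum (fun k : {k : ℤ // k ≠ 0} => f (((k : ℤ) : ℝ) ^ 2)) a) :
    PeriodicConfig.integers.energy f = ENNReal.ofReal a := by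
  have hnn : ∀ k : {k : ℤ // k ≠ 0}, 0 ≤ f (((k : ℤ) : ℝ) ^ 2) := fun k => by
    have : ((k : ℤ) : ℝ) ≠ 0 := by exact_mod_cast k.2
    exact hf ▸ hF.nonneg (by positivity)
  change ((1 : ℕ) : ℝ≥0∞)⁻¹ * ∑ j : Fin 1, ∑ k : Fin 1,
    ∑' m : {m : ℤ // (m : ℝ) * 1 + 0 - 0 ≠ 0},
      ENNReal.ofReal (f (|((m : ℤ) : ℝ) * 1 + 0 - 0| ^ 2)) = _
  rw [← h.tsum_eq, ENNReal.ofReal_tsum_of_nonneg hnn h.summable]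
  let e : {m : ℤ // (m : ℝ) * 1 + 0 - 0 ≠ 0} ≃ {k : ℤ // k ≠ 0} :=
    Equiv.subtypeEquivRight fun m => by simp
  rw [← e.tsum_eq]
  simp [e]

end interpolant

end

theorem proposition8p6 (f : ℝ → ℝ) (hf : CompletelyMonotonicOn f (Ioi 0)) (ε : ℝ) (hε : 0 < ε)
    (hdecay : f =O[atTop] fun x : ℝ => x ^ (-(1 / 2) - ε : ℝ)) :
    -- the series that define the explicit function converge absolutely
    (∀ x : ℝ, Summable fun k : {k : ℤ // k ≠ 0} => valueTerm f x k) ∧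
    (∀ x : ℝ, Summable fun k : {k : ℤ // k ≠ 0} => derivTerm f x k) ∧
    (Summable fun k : ℕ => originTerm f (k + 1)) ∧
    ∃ h hhat : ℝ → ℝ,
      (∀ x : ℝ, h x = interpolant f x) ∧
      (∀ x : ℝ, x ≠ 0 → h x ≤ f (x ^ 2)) ∧
      Continuous hhat ∧
      tsupport hhat ⊆ Icc (-1) 1 ∧
      (∀ t : ℝ, 0 ≤ hhat t) ∧
      -- `h` is the Fourier transform of `hhat`
      (∀ x : ℝ, (h x : ℂ) =
        ∫ t : ℝ, (hhat t : ℂ) * Complex.exp (2 * Real.pi * Complex.I * x * t)) ∧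
      HasSum (fun k : {k : ℤ // k ≠ 0} => f (((k : ℤ) : ℝ) ^ 2)) (hhat 0 - h 0) ∧
      -- the linear programming bound given by `h`, and its sharpness for `ℤ`
      (∀ C : PeriodicConfig, ENNReal.ofReal (C.density * hhat 0 - h 0) ≤ C.energy f) ∧
      PeriodicConfig.integers.density = 1 ∧
      PeriodicConfig.integers.energy f = ENNReal.ofReal (hhat 0 - h 0) := by
  have hF := hf.isCMTower
  set F : ℕ → ℝ → ℝ := fun k => iteratedDerivWithin k f (Ioi 0) with hFdef
  have hF0 : F 0 = f := by simp [hFdef]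
  have hs : Summable (IsCMTower.majorant F) := IsCMTower.summable_majorant hε (hF0 ▸ hdecay)
  have hle : ∀ x : ℝ, x ≠ 0 → interpolant f x ≤ f (x ^ 2) := fun x hx => by
    rw [interpolant_eq_integral hF hF0 hs, ← hF0]
    exact hF.integral_lineDual_le hs hx
  have hfour : ∀ x : ℝ, (interpolant f x : ℂ) = ∫ t : ℝ, (IsCMTower.lineTransform F t : ℂ) *
      Complex.exp (2 * Real.pi * Complex.I * x * t) := fun x => by
    rw [hF.integral_lineTransform_mul_exp hs, interpolant_eq_integral hF hF0 hs]
  have hcont := hF.continuous_lineTransform hs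
  have hsupp := IsCMTower.tsupport_lineTransform_subset F
  have hsum := hasSum_apply_sq hF hF0 hs
  refine ⟨fun x => (hasSum_valueTerm hF hF0 hs x).summable,
    fun x => (hasSum_derivTerm hF hF0 hs x).summable, summable_originTerm hF hF0 hs,
    interpolant f, IsCMTower.lineTransform F, fun x => rfl, hle, hcont, hsupp,
    hF.lineTransform_nonneg hs, hfour, hsum, fun C => ?_, ?_, energy_integers hF hF0 hsum⟩
  · refine PeriodicConfig.linear_programming_bound (p := fun x => f (|x| ^ 2)) hcont
      (HasCompactSupport.of_support_subset_isCompact isCompact_Icc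
        ((subset_tsupport _).trans hsupp)) (hF.lineTransform_nonneg hs) hfour (fun x hx => ?_)
      (fun x hx => ?_) C
    · exact hF0 ▸ hF.nonneg (by positivity)
    · rw [sq_abs]
      exact hle x hx
  · simp [PeriodicConfig.density, PeriodicConfig.integers]
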